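/- Let $m\ge 0$ and $n\ge 1$ be integers, and let $D_0,D_1,D_2$ be complex Hermitian $m\times m$ matrices such that $$\Delta(x_0,x_1,x_2)=\det(x_0D_0+x_1D_1-x_2D_2)$$ is not the zero polynomial. Let $C=\{x\in\mathbb P^2(\mathbb C):\Delta(x)=0\}$ be the plane curve with this determinantal representation. Let $p,q\in\mathbb C[x_0,x_1,x_2]$ be homogeneous of degree $n$ (the zero polynomial is allowed); for example, the homogenizations to degree $n$ of two polynomials in two variables of degree at most $n$. Let $I_n$ be the set of exponents $i=(i_0,i_1,i_2)\in\mathbb Z_{\ge0}^3$ with $i_0+i_1+i_2=n-1$, write $x^i=x_0^{i_0}x_1^{i_1}x_2^{i_2}$, let $W_n=\bigoplus_{i\in I_n}\mathbb C^m$ with its standard Hermitian inner product, and let the principal subspace $V_n\subseteq W_n$ consist of all $(w_i)_{i\in I_n}$ with $$D_0w_{j_0+1,j_1,j_2}+D_1w_{j_0,j_1+1,j_2}-D_2w_{j_0,j_1,j_2+1}=0\qquad\text{for all } j_0+j_1+j_2=n-2 .$$ Then there exist complex symmetric matrices $\beta^{10}=(b^{10}_{ij})$, $\beta^{20}=(b^{20}_{ij})$,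 $\beta^{12}=(b^{12}_{ij})$, with rows and columns indexed by $I_n$, such that $$p(x)q(y)-q(x)p(y)=\sum_{i,j\in I_n}\Big(b^{10}_{ij}x^i(x_1y_0-x_0y_1)y^j+b^{20}_{ij}x^i(x_2y_0-x_0y_2)y^j+b^{12}_{ij}x^i(x_1y_2-x_2y_1)y^j\Big).\qquad(*)$$ Moreover, for every choice of such matrices put $$B(p,q)=\beta^{12}\otimes D_0+\beta^{20}\otimes D_1+\beta^{10}\otimes D_2$$ on $W_n$, and let the generalized Bezout matrix along the curve be the operator $B'(p,q)=\mathcal P_{V_n}B(p,q)|_{V_n}:V_n\to V_n$, where $\mathcal P_{V_n}$ is the orthogonal projection of $W_n$ onto $V_n$. Then $p$ and $q$ have a common zero on $C$ if and only if $\det B'(p,q)=0$. -/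

import Mathlib

open scoped Kronecker

/-- Exponents `i = (i₀, i₁, i₂)` with `i₀ + i₁ + i₂ = n - 1`; there are `n (n + 1) / 2` of them
(none if `n = 0`). -/
abbrev MonomialIndex (n : ℕ) : Type := {i : Fin 3 → ℕ // ∑ k, i k + 1 = n}

instance MonomialIndex.instFintype (n : ℕ) : Fintype (MonomialIndex n) :=
  Fintype.subtype ((Finset.Nat.antidiagonalTuple 3 (n - 1)).filter (fun i => ∑ k, i k + 1 = n))
    (by
      intro i
      simp only [Finset.mem_filter, Finset.Nat.mem_antidiagonalTuple]
      omega)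

/-- The value at `x` of the monomial with exponent `i`, i.e. `x₀ ^ i₀ * x₁ ^ i₁ * x₂ ^ i₂`. -/
def MonomialIndex.eval {n : ℕ} (i : MonomialIndex n) (x : Fin 3 → ℂ) : ℂ :=
  ∏ k, x k ^ i.1 k

/-- For `j₀ + j₁ + j₂ = n - 2`, the exponent obtained from `j` by raising `jₖ` by one. -/
def MonomialIndex.raise {n : ℕ} (j : Fin 3 → ℕ) (hj : ∑ k, j k + 2 = n) (k : Fin 3) :
    MonomialIndex n :=
  ⟨j + Pi.single k 1, by
    simp only [Pi.add_apply, Finset.sum_add_distrib, Finset.sum_pi_single', Finset.mem_univ,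
      if_true]
    omega⟩

/-- The polynomial `Δ(x₀, x₁, x₂) = det (x₀ D₀ + x₁ D₁ - x₂ D₂)`. -/
noncomputable def determinantalPolynomial {m : ℕ} (D : Fin 3 → Matrix (Fin m) (Fin m) ℂ) :
    MvPolynomial (Fin 3) ℂ :=
  Matrix.det
    ((MvPolynomial.X 0 : MvPolynomial (Fin 3) ℂ) • (D 0).map MvPolynomial.C
      + (MvPolynomial.X 1 : MvPolynomial (Fin 3) ℂ) • (D 1).map MvPolynomial.C
      - (MvPolynomial.X 2 : MvPolynomial (Fin 3) ℂ) • (D 2).map MvPolynomial.C)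

/-- Some point of the complex projective plane, given by homogeneous coordinates `x ≠ 0`, lies on
the curve `Δ = 0` and is a zero of both `p` and `q`. -/
def HasCommonZeroOnCurve {m : ℕ} (D : Fin 3 → Matrix (Fin m) (Fin m) ℂ)
    (p q : MvPolynomial (Fin 3) ℂ) : Prop :=
  ∃ x : Fin 3 → ℂ, x ≠ 0 ∧ MvPolynomial.eval x (determinantalPolynomial D) = 0 ∧
    MvPolynomial.eval x p = 0 ∧ MvPolynomial.eval x q = 0

/-- The blown up space `W_n` of families `(w_i)` of vectors of `ℂ ^ m`, with its Hermitian inner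
product. -/
abbrev BlownSpace (m n : ℕ) : Type := EuclideanSpace ℂ (MonomialIndex n × Fin m)

/-- The component `w_i ∈ ℂ ^ m` of `w ∈ W_n`. -/
def BlownSpace.component {m n : ℕ} (w : BlownSpace m n) (i : MonomialIndex n) : Fin m → ℂ :=
  fun a => w (i, a)

/-- The principal subspace `V_n` of `W_n`: the families `w` with
`D₀ w_{j₀+1,j₁,j₂} + D₁ w_{j₀,j₁+1,j₂} - D₂ w_{j₀,j₁,j₂+1} = 0` for all `j₀ + j₁ + j₂ = n - 2`. -/
def principalSubspace {m : ℕ} (D : Fin 3 → Matrix (Fin m) (Fin m) ℂ) (n : ℕ) :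
    Submodule ℂ (BlownSpace m n) where
  carrier := {w | ∀ (j : Fin 3 → ℕ) (hj : ∑ k, j k + 2 = n),
    (D 0).mulVec (w.component (MonomialIndex.raise j hj 0))
      + (D 1).mulVec (w.component (MonomialIndex.raise j hj 1))
      - (D 2).mulVec (w.component (MonomialIndex.raise j hj 2)) = 0}
  zero_mem' := by
    intro j hj
    have h : ∀ i : MonomialIndex n, (0 : BlownSpace m n).component i = 0 := fun i => rfl
    simp [h]
  add_mem' := by
    intro v w hv hw j hj
    have h : ∀ i : MonomialIndex n, (v + w).component i = v.component i + w.component i :=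
      fun i => rfl
    have h' := congrArg₂ (· + ·) (hv j hj) (hw j hj)
    simp only [h, Matrix.mulVec_add]
    simp only [add_zero] at h'
    rw [← h']
    abel
  smul_mem' := by
    intro c w hw j hj
    have h : ∀ i : MonomialIndex n, (c • w).component i = c • w.component i := fun i => rfl
    have h' := congrArg (c • ·) (hw j hj)
    simp only [h, Matrix.mulVec_smul]
    simpa only [smul_sub, smul_add, smul_zero] using h'

/-- The three symmetric coefficient matrices `β¹⁰`, `β²⁰`, `β¹²` are Bezout coefficients of the
forms `p` and `q` of degree `n`. The identity of polynomials in `(x, y)` is stated as equality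
of values at all complex points. -/
structure IsBezoutTriple {n : ℕ} (p q : MvPolynomial (Fin 3) ℂ)
    (β10 β20 β12 : Matrix (MonomialIndex n) (MonomialIndex n) ℂ) : Prop where
  symm10 : β10.IsSymm
  symm20 : β20.IsSymm
  symm12 : β12.IsSymm
  identity : ∀ x y : Fin 3 → ℂ,
    MvPolynomial.eval x p * MvPolynomial.eval y q - MvPolynomial.eval x q * MvPolynomial.eval y p
      = ∑ i : MonomialIndex n, ∑ j : MonomialIndex n,
        (β10 i j * i.eval x * (x 1 * y 0 - x 0 * y 1) * j.eval y
          + β20 i j * i.eval x * (x 2 * y 0 - x 0 * y 2) * j.eval y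
          + β12 i j * i.eval x * (x 1 * y 2 - x 2 * y 1) * j.eval y)

/-- The matrix `B = β¹² ⊗ D₀ + β²⁰ ⊗ D₁ + β¹⁰ ⊗ D₂` on the blown up space `W_n`. -/
def blownBezoutMatrix {m n : ℕ} (D : Fin 3 → Matrix (Fin m) (Fin m) ℂ)
    (β10 β20 β12 : Matrix (MonomialIndex n) (MonomialIndex n) ℂ) :
    Matrix (MonomialIndex n × Fin m) (MonomialIndex n × Fin m) ℂ :=
  β12 ⊗ₖ D 0 + β20 ⊗ₖ D 1 + β10 ⊗ₖ D 2

/-- The generalized Bezout matrix along the curve: the compression `P_{V_n} B P_{V_n}` of `B` to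
the principal subspace `V_n`, as an operator on `V_n`. -/
noncomputable def bezoutAlongCurve {m n : ℕ} (D : Fin 3 → Matrix (Fin m) (Fin m) ℂ)
    (β10 β20 β12 : Matrix (MonomialIndex n) (MonomialIndex n) ℂ) :
    principalSubspace D n →ₗ[ℂ] principalSubspace D n :=
  (principalSubspace D n).orthogonalProjectionOnto.toLinearMap
    ∘ₗ Matrix.toEuclideanLin (blownBezoutMatrix D β10 β20 β12)
    ∘ₗ (principalSubspace D n).subtype

/-! Let S = ℂ[x₀, x₁, x₂], d = (D₀, D₁, -D₂) and A = ∑ xₖ dₖ. A family w in V_n is the same as a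
linear map φ : S → ℂᵐ concentrated in degree n - 1 with ∑ dₖ φ(xₖ f) = 0 for all f, that is, a
functional on the cokernel of Aᵀ. Applying φ in the variable y to ∑ dₖ bₖ(x, y) gives a polynomial
vector B(φ) in x. As the Dₖ are Hermitian, conjugation carries V_n to the same space for the
transposed pencil, which is dual to the cokernel of A in degree n - 1. Hence B' w = 0 exactly when
B(φ) lies in the image of A (`bezoutAlongCurve_eq_zero_iff`).

At a common zero y on the curve, take ξ ≠ 0 in ker A(y) and φ(f) = f(y) ξ. By (*) the vector (bₖ(x,
y))ₖ is orthogonal to x × y, so it equals r(x) x + e(x) y with polynomials r, e, and B(φ) = A(r ξ) +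
e A(y) ξ = A(r ξ).

Conversely, assume that there is no common zero. Replacing (p, q) by (-q, p + c q) preserves (*)
and, for suitable c, makes q nonzero at the finitely many points where the curve meets a line ℓ = 0
through a point off the curve. Then ℓ, q is a regular sequence on the cokernels of A and Aᵀ, so a
kernel functional can be divided: φ(f) = φ'(ℓ f). The relations (x × y)ₖ B ≡ dₖ (p(x) q(y) - q(x)
p(y)) modulo A(x) and A(y) show that φ' is again of kernel type, one degree higher and killed by p
and q (`IsBezoutKernel.exists_mulShift_eq`). Iterating, φ(f) = φ'(ℓ^e f) for every e, with φ'
depending on e. By the Nullstellensatz ℓ^e ∈ (p, q, det A) for some e, and these three polynomials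
kill φ', so φ = 0. -/

open MvPolynomial

/-! ### Regular elements on the cokernel of a square matrix -/

section Regularity

variable {R ι : Type*} [CommRing R] [Fintype ι] [DecidableEq ι]

/-- A prime that does not divide `det A` is regular on the cokernel of `A`. -/
theorem exists_eq_mulVec_of_prime_smul [IsDomain R] {A : Matrix ι ι R} {π : R} (hπ : Prime π)
    (hA : ¬ π ∣ A.det) {F H : ι → R} (h : π • F = A.mulVec H) : ∃ G, F = A.mulVec G := by
  have h1 : π • A.adjugate.mulVec F = A.det • H := by
    rw [← Matrix.mulVec_smul, h, Matrix.mulVec_mulVec, Matrix.adjugate_mul, Matrix.smul_mulVec,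
      Matrix.one_mulVec]
  have h2 : ∀ a, π ∣ H a := fun a => by
    have h3 : π ∣ A.det * H a := ⟨A.adjugate.mulVec F a, by simpa using (congrFun h1 a).symm⟩
    exact (hπ.dvd_or_dvd h3).resolve_left hA
  choose G hG using h2
  have hHG : H = π • G := funext fun a => by simp [hG a]
  refine ⟨G, ?_⟩
  rw [hHG, Matrix.mulVec_smul] at h
  exact smul_right_injective _ hπ.ne_zero h

/-- If `π` is prime, `(π, μ)` is a prime ideal not containing `det A`, then `μ` is regular on the
cokernel of `A` modulo `π`. -/
theorem exists_eq_smul_add_mulVec_of_smul {A : Matrix ι ι R} {π μ : R} (hπ : Prime π)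
    (hμ : ¬ π ∣ μ) (hP : (Ideal.span {π, μ}).IsPrime) (hA : A.det ∉ Ideal.span {π, μ})
    {F G H : ι → R} (h : μ • F = π • G + A.mulVec H) :
    ∃ G' H', F = π • G' + A.mulVec H' := by
  -- The adjugate turns the relation into det A · H ∈ (π, μ) entrywise, and primality removes det A.
  have h1 : A.det • H = μ • A.adjugate.mulVec F - π • A.adjugate.mulVec G := by
    rw [← Matrix.mulVec_smul, h, Matrix.mulVec_add, Matrix.mulVec_mulVec, Matrix.adjugate_mul,
      Matrix.smul_mulVec, Matrix.one_mulVec, Matrix.mulVec_smul]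
    abel
  have h2 : ∀ a, ∃ u w, u * π + w * μ = H a := fun a => by
    have h3 : A.det * H a ∈ Ideal.span {π, μ} := by
      have := congrFun h1 a
      simp only [Pi.smul_apply, Pi.sub_apply, smul_eq_mul] at this
      rw [this]
      exact Ideal.sub_mem _ (Ideal.mul_mem_right _ _ (Ideal.subset_span (by simp)))
        (Ideal.mul_mem_right _ _ (Ideal.subset_span (by simp)))
    exact Ideal.mem_span_pair.1 ((hP.mem_or_mem h3).resolve_left hA)
  choose u w huw using h2
  have hH : H = π • u + μ • w := funext fun a => by simp [← huw a, mul_comm]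
  have h4 : μ • (F - A.mulVec w) = π • (G + A.mulVec u) := by
    rw [smul_sub, h, hH, Matrix.mulVec_add, Matrix.mulVec_smul, Matrix.mulVec_smul, smul_add]
    abel
  have h5 : ∀ a, π ∣ (F - A.mulVec w) a := fun a =>
    (hπ.dvd_or_dvd ⟨_, congrFun h4 a⟩).resolve_left hμ
  choose K hK using h5
  refine ⟨K, w, ?_⟩
  have : F - A.mulVec w = π • K := funext fun a => by simpa using hK a
  rw [← this]; abel

/-- If a power of `μ` lies in `(q, det A, π)`, then `q` is regular on the cokernel of `A` modulo
`π`. -/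
theorem exists_eq_smul_add_mulVec_of_pow_mem {A : Matrix ι ι R} {π μ q : R} (hπ : Prime π)
    (hμ : ¬ π ∣ μ) (hP : (Ideal.span {π, μ}).IsPrime) (hA : A.det ∉ Ideal.span {π, μ})
    {r : ℕ} (hr : μ ^ r ∈ Ideal.span {q, A.det, π})
    {F G H : ι → R} (h : q • F = π • G + A.mulVec H) :
    ∃ G' H', F = π • G' + A.mulVec H' := by
  obtain ⟨u, w, t, hs⟩ : ∃ u w t, μ ^ r = u * q + w * A.det + t * π := by
    obtain ⟨u, z, hz, h1⟩ := Ideal.mem_span_insert.1 hr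
    obtain ⟨w, t, h2⟩ := Ideal.mem_span_pair.1 hz
    exact ⟨u, w, t, by rw [h1, ← h2]; ring⟩
  -- Modulo π and the image of A, both q F and det A · F = A (adj A) F vanish, hence so does μ ^ r
  -- F. The factors μ are then cancelled one at a time.
  have key : ∃ G' H', μ ^ r • F = π • G' + A.mulVec H' := by
    refine ⟨u • G + t • F, u • H + w • A.adjugate.mulVec F, ?_⟩
    have e : A.mulVec (A.adjugate.mulVec F) = A.det • F := by
      rw [Matrix.mulVec_mulVec, Matrix.mul_adjugate, Matrix.smul_mulVec, Matrix.one_mulVec]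
    rw [hs, add_smul, add_smul, mul_smul, h, Matrix.mulVec_add, Matrix.mulVec_smul,
      Matrix.mulVec_smul, e]
    module
  clear hr h hs
  induction r with
  | zero => simpa using key
  | succ r ih =>
    obtain ⟨G', H', h'⟩ := key
    rw [pow_succ', mul_smul] at h'
    exact ih (exists_eq_smul_add_mulVec_of_smul hπ hμ hP hA h')

end Regularity

/-! ### Prime ideals of a line and a point, and the Nullstellensatz -/

section Primes

/-- Modulo I every f agrees with its substitution f(g), so I is the kernel of the substitution, a
map into a domain. -/
theorem isPrime_of_aeval_retract {σ : Type*} {I : Ideal (MvPolynomial σ ℂ)}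
    (g : σ → MvPolynomial σ ℂ) (h1 : ∀ k, X k - g k ∈ I) (h2 : ∀ f ∈ I, aeval g f = 0) :
    I.IsPrime := by
  have e : I = RingHom.ker (aeval g : MvPolynomial σ ℂ →ₐ[ℂ] _) := by
    ext f
    refine ⟨fun hf => h2 f hf, fun hf => ?_⟩
    have hh : ((Ideal.Quotient.mkₐ ℂ I).comp (aeval g)) = Ideal.Quotient.mkₐ ℂ I := by
      refine algHom_ext fun k => ?_
      simp only [AlgHom.comp_apply, aeval_X, Ideal.Quotient.mkₐ_eq_mk]
      exact (Ideal.Quotient.eq.2 (h1 k)).symm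
    have := DFunLike.congr_fun hh f
    rw [AlgHom.comp_apply, (show aeval g f = 0 from hf), map_zero] at this
    exact Ideal.Quotient.eq_zero_iff_mem.1 this.symm
  rw [e]
  exact RingHom.ker_isPrime _

theorem prime_X_sub_C_mul_X {σ : Type*} [DecidableEq σ] {i j : σ} (hij : i ≠ j) (a : ℂ) :
    Prime (X j - C a * X i : MvPolynomial σ ℂ) := by
  have hne : (X j - C a * X i : MvPolynomial σ ℂ) ≠ 0 := fun h => by
    have := congrArg (eval (Pi.single j (1 : ℂ))) h
    simp [hij] at this
  rw [← Ideal.span_singleton_prime hne]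
  refine isPrime_of_aeval_retract (Function.update X j (C a * X i)) (fun k => ?_) (fun f hf => ?_)
  · by_cases hk : k = j
    · subst hk; simp
    · simp [hk]
  · obtain ⟨u, rfl⟩ := Ideal.mem_span_singleton.1 hf
    simp [hij, algebraMap_eq]

theorem isPrime_span_pair (a b : ℂ) :
    (Ideal.span {X 0 - C a * X 1, X 2 - C b * X 1} : Ideal (MvPolynomial (Fin 3) ℂ)).IsPrime := by
  refine isPrime_of_aeval_retract ![C a * X 1, X 1, C b * X 1] (fun k => ?_) (fun f hf => ?_)
  · fin_cases k
    · exact Ideal.subset_span (by simp)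
    · simp
    · exact Ideal.subset_span (by simp)
  · obtain ⟨u, w, rfl⟩ := Ideal.mem_span_pair.1 hf
    simp [algebraMap_eq]

/-- Nullstellensatz: a polynomial vanishing on the common zeros of a set has a power in the
ideal that the set spans. -/
theorem exists_pow_mem_span_of_eval {σ : Type*} [Finite σ] {s : Set (MvPolynomial σ ℂ)}
    {f : MvPolynomial σ ℂ} (h : ∀ x : σ → ℂ, (∀ g ∈ s, eval x g = 0) → eval x f = 0) :
    ∃ r, f ^ r ∈ Ideal.span s := by
  have : f ∈ (Ideal.span s).radical := by
    rw [← vanishingIdeal_zeroLocus_eq_radical (K := ℂ), mem_vanishingIdeal_iff]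
    intro x hx
    rw [zeroLocus_span] at hx
    simpa [aeval_eq_eval] using h x (fun g hg => by simpa [aeval_eq_eval] using hx g hg)
  exact this

end Primes

/-! ### Dividing functionals by a regular element -/

section Extension

variable {S M : Type*} [CommRing S] [Algebra ℂ S] [AddCommGroup M] [Module S M] [Module ℂ M]
  [IsScalarTower ℂ S M]

/-- Multiplication by s is injective on M/N, so its transpose on ℂ-linear duals is surjective. -/
theorem exists_functional_smul_eq (N : Submodule S M) (s : S)
    (hs : ∀ F, s • F ∈ N → F ∈ N) (ψ : M →ₗ[ℂ] ℂ) (hψ : ∀ F ∈ N, ψ F = 0) :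
    ∃ ψ' : M →ₗ[ℂ] ℂ, (∀ F ∈ N, ψ' F = 0) ∧ ∀ F, ψ' (s • F) = ψ F := by
  let N' := N.restrictScalars ℂ
  let μ : M →ₗ[ℂ] M := (LinearMap.lsmul S M s).restrictScalars ℂ
  have hμ : N' ≤ N'.comap μ := fun F hF => N.smul_mem s hF
  have hinj : Function.Injective (N'.mapQ N' μ hμ) := by
    rw [← LinearMap.ker_eq_bot, LinearMap.ker_eq_bot']
    intro x
    induction x using Submodule.Quotient.induction_on with
    | H F =>
      intro h
      rw [Submodule.mapQ_apply, Submodule.Quotient.mk_eq_zero] at h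
      exact (Submodule.Quotient.mk_eq_zero _).2 (hs F h)
  obtain ⟨χ, hχ⟩ := LinearMap.dualMap_surjective_of_injective hinj
    (N'.liftQ ψ (fun F hF => hψ F hF))
  refine ⟨χ ∘ₗ N'.mkQ, fun F hF => ?_, fun F => ?_⟩
  · have : N'.mkQ F = 0 := (Submodule.Quotient.mk_eq_zero _).2 hF
    simp [this]
  · exact DFunLike.congr_fun hχ (N'.mkQ F)

end Extension

/-! ### Principal functionals as functionals on the cokernel of the transposed pencil -/

section Functionals

variable {m n : ℕ}

/-- The matrix of linear forms `x₀ d₀ + x₁ d₁ + x₂ d₂`. -/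
noncomputable def pencil (d : Fin 3 → Matrix (Fin m) (Fin m) ℂ) :
    Matrix (Fin m) (Fin m) (MvPolynomial (Fin 3) ℂ) :=
  ∑ k, (X k : MvPolynomial (Fin 3) ℂ) • (d k).map C

theorem pencil_transpose (d : Fin 3 → Matrix (Fin m) (Fin m) ℂ) :
    (pencil d).transpose = pencil fun k => (d k).transpose := by
  simp [pencil, Matrix.transpose_sum, Matrix.transpose_map]

/-- Vector-valued functionals on polynomials that satisfy the relations of the principal
subspace. -/
def IsPrincipal (d : Fin 3 → Matrix (Fin m) (Fin m) ℂ)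
    (φ : MvPolynomial (Fin 3) ℂ →ₗ[ℂ] (Fin m → ℂ)) : Prop :=
  ∀ f, ∑ k, (d k).mulVec (φ (X k * f)) = 0

/-- The functional `f ↦ φ (g f)`. -/
noncomputable def mulShift (g : MvPolynomial (Fin 3) ℂ)
    (φ : MvPolynomial (Fin 3) ℂ →ₗ[ℂ] (Fin m → ℂ)) :
    MvPolynomial (Fin 3) ℂ →ₗ[ℂ] (Fin m → ℂ) :=
  φ ∘ₗ LinearMap.mulLeft ℂ g

@[simp]
theorem mulShift_apply (g f : MvPolynomial (Fin 3) ℂ)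
    (φ : MvPolynomial (Fin 3) ℂ →ₗ[ℂ] (Fin m → ℂ)) : mulShift g φ f = φ (g * f) := rfl

theorem mulShift_mul (g h : MvPolynomial (Fin 3) ℂ)
    (φ : MvPolynomial (Fin 3) ℂ →ₗ[ℂ] (Fin m → ℂ)) :
    mulShift g (mulShift h φ) = mulShift (g * h) φ := by
  refine LinearMap.ext fun f => ?_
  rw [mulShift_apply, mulShift_apply, mulShift_apply, mul_left_comm, mul_assoc]

theorem mulShift_C (c : ℂ) (φ : MvPolynomial (Fin 3) ℂ →ₗ[ℂ] (Fin m → ℂ)) :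
    mulShift (C c) φ = c • φ := LinearMap.ext fun f => by
  rw [mulShift_apply, ← smul_eq_C_mul, map_smul]; rfl

theorem mulShift_add (g h : MvPolynomial (Fin 3) ℂ)
    (φ : MvPolynomial (Fin 3) ℂ →ₗ[ℂ] (Fin m → ℂ)) :
    mulShift (g + h) φ = mulShift g φ + mulShift h φ := LinearMap.ext fun f => by
  simp [add_mul]

theorem IsPrincipal.mulShift {d : Fin 3 → Matrix (Fin m) (Fin m) ℂ}
    {φ : MvPolynomial (Fin 3) ℂ →ₗ[ℂ] (Fin m → ℂ)} (h : IsPrincipal d φ)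
    (g : MvPolynomial (Fin 3) ℂ) : IsPrincipal d (mulShift g φ) := fun f => by
  simpa only [mulShift_apply, mul_left_comm] using h (g * f)

/-- The scalar functional on polynomial vectors attached to `φ`. -/
noncomputable def toFunctional (φ : MvPolynomial (Fin 3) ℂ →ₗ[ℂ] (Fin m → ℂ)) :
    (Fin m → MvPolynomial (Fin 3) ℂ) →ₗ[ℂ] ℂ :=
  ∑ a, LinearMap.proj a ∘ₗ φ ∘ₗ LinearMap.proj a

theorem toFunctional_apply (φ : MvPolynomial (Fin 3) ℂ →ₗ[ℂ] (Fin m → ℂ))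
    (F : Fin m → MvPolynomial (Fin 3) ℂ) : toFunctional φ F = ∑ a, φ (F a) a := by
  simp [toFunctional]

/-- The vector-valued functional attached to a scalar functional on polynomial vectors. -/
noncomputable def ofFunctional (ψ : (Fin m → MvPolynomial (Fin 3) ℂ) →ₗ[ℂ] ℂ) :
    MvPolynomial (Fin 3) ℂ →ₗ[ℂ] (Fin m → ℂ) :=
  LinearMap.pi fun a => ψ ∘ₗ LinearMap.single ℂ (fun _ => MvPolynomial (Fin 3) ℂ) a

@[simp]
theorem ofFunctional_apply (ψ : (Fin m → MvPolynomial (Fin 3) ℂ) →ₗ[ℂ] ℂ)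
    (f : MvPolynomial (Fin 3) ℂ) (a : Fin m) : ofFunctional ψ f a = ψ (Pi.single a f) := rfl

theorem toFunctional_ofFunctional (ψ : (Fin m → MvPolynomial (Fin 3) ℂ) →ₗ[ℂ] ℂ) :
    toFunctional (ofFunctional ψ) = ψ := by
  refine LinearMap.ext fun F => ?_
  rw [toFunctional_apply]
  simp only [ofFunctional_apply, ← map_sum]
  congr 1
  exact Finset.univ_sum_single F

/-- This links the two descriptions: the relations of a principal functional say precisely that its
scalar form annihilates the image of the transposed pencil. -/
theorem toFunctional_pencil_transpose (d : Fin 3 → Matrix (Fin m) (Fin m) ℂ)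
    (φ : MvPolynomial (Fin 3) ℂ →ₗ[ℂ] (Fin m → ℂ)) (G : Fin m → MvPolynomial (Fin 3) ℂ) :
    toFunctional φ ((pencil d).transpose.mulVec G)
      = ∑ b, (∑ k, (d k).mulVec (φ (X k * G b))) b := by
  have h : ∀ (k : Fin 3) (a b : Fin m),
      φ (X k * C (d k b a) * G b) a = d k b a * φ (X k * G b) a := fun k a b => by
    rw [show X k * C (d k b a) * G b = d k b a • (X k * G b) by rw [smul_eq_C_mul]; ring,
      map_smul]
    simp
  simp only [toFunctional_apply, pencil, Matrix.mulVec, dotProduct, Matrix.transpose_apply,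
    Matrix.sum_apply, Matrix.smul_apply, Matrix.map_apply, smul_eq_mul, Finset.sum_mul, map_sum,
    Finset.sum_apply, h]
  rw [Finset.sum_comm]
  exact Finset.sum_congr rfl fun b _ => Finset.sum_comm

theorem IsPrincipal.toFunctional_eq_zero {d : Fin 3 → Matrix (Fin m) (Fin m) ℂ}
    {φ : MvPolynomial (Fin 3) ℂ →ₗ[ℂ] (Fin m → ℂ)} (h : IsPrincipal d φ)
    (G : Fin m → MvPolynomial (Fin 3) ℂ) :
    toFunctional φ ((pencil d).transpose.mulVec G) = 0 := by
  rw [toFunctional_pencil_transpose]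
  exact Finset.sum_eq_zero fun b _ => by rw [h]; rfl

theorem isPrincipal_ofFunctional {d : Fin 3 → Matrix (Fin m) (Fin m) ℂ}
    {ψ : (Fin m → MvPolynomial (Fin 3) ℂ) →ₗ[ℂ] ℂ}
    (h : ∀ G, ψ ((pencil d).transpose.mulVec G) = 0) : IsPrincipal d (ofFunctional ψ) := by
  intro f
  ext b
  have := h (Pi.single b f)
  rw [← toFunctional_ofFunctional ψ, toFunctional_pencil_transpose,
    Finset.sum_eq_single b] at this
  · simpa using this
  · intro c _ hc
    simp [Pi.single_eq_of_ne hc]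
  · simp

/-- A principal functional killed by `q` can be divided by a linear form `ℓ` if `(ℓ, q)` is a
regular sequence on the cokernel. -/
theorem IsPrincipal.exists_mulShift_eq {d : Fin 3 → Matrix (Fin m) (Fin m) ℂ}
    {φ : MvPolynomial (Fin 3) ℂ →ₗ[ℂ] (Fin m → ℂ)} (h : IsPrincipal d φ)
    {ℓ q : MvPolynomial (Fin 3) ℂ}
    (hℓ : ∀ F H, ℓ • F = (pencil d).transpose.mulVec H → ∃ G, F = (pencil d).transpose.mulVec G)
    (hq : ∀ F G H, q • F = ℓ • G + (pencil d).transpose.mulVec H →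
      ∃ G' H', F = ℓ • G' + (pencil d).transpose.mulVec H')
    (hφ : _root_.mulShift q φ = 0) :
    ∃ φ', IsPrincipal d φ' ∧ _root_.mulShift ℓ φ' = φ ∧ _root_.mulShift q φ' = 0 := by
  set A := (pencil d).transpose with hA
  let N : Submodule (MvPolynomial (Fin 3) ℂ) (Fin m → MvPolynomial (Fin 3) ℂ) :=
    LinearMap.range A.mulVecLin ⊔ LinearMap.range (LinearMap.lsmul _ _ q)
  have hN : ∀ F, F ∈ N ↔ ∃ H G, A.mulVec H + q • G = F := by
    intro F
    simp [N, Submodule.mem_sup]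
  -- Regularity of ℓ, q in this order gives regularity of ℓ modulo q. If ℓ F = A H + q G, then G = ℓ
  -- G' + A H', so ℓ (F - q G') = A (H + q H') and F - q G' lies in the image of A.
  obtain ⟨ψ, h1, h2⟩ := exists_functional_smul_eq N ℓ (fun F hF => by
      obtain ⟨H, G, e⟩ := (hN _).1 hF
      obtain ⟨G', H', e'⟩ := hq G F (-H) (by rw [← e, Matrix.mulVec_neg]; abel)
      obtain ⟨K, hK⟩ := hℓ (F - q • G') (H + q • H') (by
        rw [smul_sub, ← e, e', Matrix.mulVec_add, Matrix.mulVec_smul, smul_add, smul_comm q ℓ]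
        abel)
      exact (hN _).2 ⟨K, G', by rw [← hK]; abel⟩)
    (toFunctional φ) (fun F hF => by
      obtain ⟨H, G, rfl⟩ := (hN _).1 hF
      have e : ∀ f, φ (q * f) = 0 := fun f => DFunLike.congr_fun hφ f
      rw [map_add, h.toFunctional_eq_zero, toFunctional_apply]
      simp [e])
  refine ⟨ofFunctional ψ, isPrincipal_ofFunctional fun G => h1 _ ((hN _).2 ⟨G, 0, by simp [hA]⟩),
    ?_, ?_⟩
  · refine LinearMap.ext fun f => funext fun a => ?_
    have := h2 (Pi.single a f)
    rw [← Pi.single_smul, smul_eq_mul] at this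
    rw [mulShift_apply, ofFunctional_apply, this, toFunctional_apply, Finset.sum_eq_single a]
    · simp
    · intro c _ hc
      simp [Pi.single_eq_of_ne hc]
    · simp
  · refine LinearMap.ext fun f => funext fun a => ?_
    rw [mulShift_apply, ofFunctional_apply, ← smul_eq_mul, Pi.single_smul]
    exact h1 _ ((hN _).2 ⟨0, Pi.single a f, by simp⟩)

end Functionals

/-! ### The Bezoutian applied to a functional, and its relations -/

section BezoutVector

variable {m n : ℕ}

/-- The monomial with exponent `i`. -/
noncomputable def MonomialIndex.toPoly (i : MonomialIndex n) : MvPolynomial (Fin 3) ℂ :=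
  monomial (Finsupp.equivFunOnFinite.symm i.1) 1

@[simp]
theorem MonomialIndex.eval_toPoly (i : MonomialIndex n) (x : Fin 3 → ℂ) :
    MvPolynomial.eval x i.toPoly = i.eval x := by
  simp [toPoly, MonomialIndex.eval, eval_monomial, Finsupp.prod_fintype]

/-- The polynomial `∑ β i j x^i y^j` in `y`, for a given `x`. -/
noncomputable def bezoutSlice (β : Matrix (MonomialIndex n) (MonomialIndex n) ℂ)
    (x : Fin 3 → ℂ) : MvPolynomial (Fin 3) ℂ :=
  ∑ i, ∑ j, C (β i j * i.eval x) * j.toPoly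

/-- The polynomial vector obtained by applying `φ` to `∑ β i j x^i y^j` as polynomial in `y`. -/
noncomputable def bezoutRow (β : Matrix (MonomialIndex n) (MonomialIndex n) ℂ)
    (φ : MvPolynomial (Fin 3) ℂ →ₗ[ℂ] (Fin m → ℂ)) : Fin m → MvPolynomial (Fin 3) ℂ :=
  fun a => ∑ i, ∑ j, C (β i j * φ j.toPoly a) * i.toPoly

theorem eval_bezoutRow (β : Matrix (MonomialIndex n) (MonomialIndex n) ℂ)
    (φ : MvPolynomial (Fin 3) ℂ →ₗ[ℂ] (Fin m → ℂ)) (a : Fin m) (x : Fin 3 → ℂ) :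
    eval x (bezoutRow β φ a) = φ (bezoutSlice β x) a := by
  simp only [bezoutRow, bezoutSlice, map_sum, ← smul_eq_C_mul, map_smul, Finset.sum_apply,
    Pi.smul_apply, smul_eq_mul, smul_eval, MonomialIndex.eval_toPoly]
  exact Finset.sum_congr rfl fun i _ => Finset.sum_congr rfl fun j _ => by ring

theorem bezoutRow_add (β : Matrix (MonomialIndex n) (MonomialIndex n) ℂ)
    (φ ψ : MvPolynomial (Fin 3) ℂ →ₗ[ℂ] (Fin m → ℂ)) :
    bezoutRow β (φ + ψ) = bezoutRow β φ + bezoutRow β ψ := by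
  ext1 a
  refine MvPolynomial.funext fun x => ?_
  simp [eval_bezoutRow]

theorem bezoutRow_smul (β : Matrix (MonomialIndex n) (MonomialIndex n) ℂ) (c : ℂ)
    (φ : MvPolynomial (Fin 3) ℂ →ₗ[ℂ] (Fin m → ℂ)) :
    bezoutRow β (c • φ) = (C c : MvPolynomial (Fin 3) ℂ) • bezoutRow β φ := by
  ext1 a
  refine MvPolynomial.funext fun x => ?_
  simp [eval_bezoutRow]

/-- The Bezoutian along the pencil, applied to a functional in its second variable. -/
noncomputable def bezoutVector (d : Fin 3 → Matrix (Fin m) (Fin m) ℂ)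
    (b : Fin 3 → Matrix (MonomialIndex n) (MonomialIndex n) ℂ)
    (φ : MvPolynomial (Fin 3) ℂ →ₗ[ℂ] (Fin m → ℂ)) : Fin m → MvPolynomial (Fin 3) ℂ :=
  ∑ k, ((d k).map C).mulVec (bezoutRow (b k) φ)

theorem bezoutVector_add (d : Fin 3 → Matrix (Fin m) (Fin m) ℂ)
    (b : Fin 3 → Matrix (MonomialIndex n) (MonomialIndex n) ℂ)
    (φ ψ : MvPolynomial (Fin 3) ℂ →ₗ[ℂ] (Fin m → ℂ)) :
    bezoutVector d b (φ + ψ) = bezoutVector d b φ + bezoutVector d b ψ := by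
  simp only [bezoutVector, bezoutRow_add, Matrix.mulVec_add, Finset.sum_add_distrib]

theorem bezoutVector_smul (d : Fin 3 → Matrix (Fin m) (Fin m) ℂ)
    (b : Fin 3 → Matrix (MonomialIndex n) (MonomialIndex n) ℂ) (c : ℂ)
    (φ : MvPolynomial (Fin 3) ℂ →ₗ[ℂ] (Fin m → ℂ)) :
    bezoutVector d b (c • φ) = (C c : MvPolynomial (Fin 3) ℂ) • bezoutVector d b φ := by
  simp only [bezoutVector, bezoutRow_smul, Matrix.mulVec_smul, Finset.smul_sum]

/-- The Bezout identity for the three coefficient matrices, in cyclic notation. -/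
def BezoutIdentity (b : Fin 3 → Matrix (MonomialIndex n) (MonomialIndex n) ℂ)
    (p q : MvPolynomial (Fin 3) ℂ) : Prop :=
  ∀ x y : Fin 3 → ℂ, eval x p * eval y q - eval x q * eval y p
    = ∑ k, (x (k + 1) * y (k + 2) - x (k + 2) * y (k + 1))
        * ∑ i, ∑ j, b k i j * MonomialIndex.eval i x * MonomialIndex.eval j y

/-- Freezing x makes the identity one of polynomials in y, to which a functional can be applied. -/
theorem BezoutIdentity.slice {b : Fin 3 → Matrix (MonomialIndex n) (MonomialIndex n) ℂ}
    {p q : MvPolynomial (Fin 3) ℂ} (h : BezoutIdentity b p q) (x : Fin 3 → ℂ) :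
    C (eval x p) * q - C (eval x q) * p
      = ∑ k, (C (x (k + 1)) * X (k + 2) - C (x (k + 2)) * X (k + 1)) * bezoutSlice (b k) x := by
  refine MvPolynomial.funext fun y => ?_
  simpa [bezoutSlice] using h x y

theorem BezoutIdentity.sum_bezoutRow
    {b : Fin 3 → Matrix (MonomialIndex n) (MonomialIndex n) ℂ}
    {p q : MvPolynomial (Fin 3) ℂ} (h : BezoutIdentity b p q)
    (φ : MvPolynomial (Fin 3) ℂ →ₗ[ℂ] (Fin m → ℂ)) :
    ∑ k : Fin 3, ((X (k + 1) : MvPolynomial (Fin 3) ℂ) • bezoutRow (b k) (mulShift (X (k + 2)) φ)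
        - (X (k + 2) : MvPolynomial (Fin 3) ℂ) • bezoutRow (b k) (mulShift (X (k + 1)) φ))
      = fun a => p * C (φ q a) - q * C (φ p a) := by
  ext1 a
  refine MvPolynomial.funext fun x => ?_
  have := congrFun (congrArg φ (h.slice x)) a
  simp only [sub_mul, ← smul_eq_C_mul, map_sub, map_smul, map_sum, Pi.sub_apply,
    Finset.sum_apply, Pi.smul_apply, smul_eq_mul] at this
  simp [eval_bezoutRow, this]

theorem IsPrincipal.sum_bezoutRow {d : Fin 3 → Matrix (Fin m) (Fin m) ℂ}
    {φ : MvPolynomial (Fin 3) ℂ →ₗ[ℂ] (Fin m → ℂ)} (h : IsPrincipal d φ)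
    (β : Matrix (MonomialIndex n) (MonomialIndex n) ℂ) :
    ∑ k, ((d k).map C).mulVec (bezoutRow β (_root_.mulShift (X k) φ)) = 0 := by
  ext1 a
  refine MvPolynomial.funext fun x => ?_
  have := congrFun (h (bezoutSlice β x)) a
  simpa [Matrix.mulVec, dotProduct, eval_bezoutRow] using this

/-- The relation `(x × y)ₖ B ≡ dₖ (p(x) q(y) - q(x) p(y))` modulo the pencil, after a principal
functional has been applied in `y`. -/
theorem IsPrincipal.bezoutVector_relation {d : Fin 3 → Matrix (Fin m) (Fin m) ℂ}
    {φ : MvPolynomial (Fin 3) ℂ →ₗ[ℂ] (Fin m → ℂ)} (h : IsPrincipal d φ)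
    {b : Fin 3 → Matrix (MonomialIndex n) (MonomialIndex n) ℂ}
    {p q : MvPolynomial (Fin 3) ℂ} (hb : BezoutIdentity b p q) (k : Fin 3) :
    ∃ H, (X (k + 1) : MvPolynomial (Fin 3) ℂ) • bezoutVector d b (_root_.mulShift (X (k + 2)) φ)
        - (X (k + 2) : MvPolynomial (Fin 3) ℂ) • bezoutVector d b (_root_.mulShift (X (k + 1)) φ)
      = p • ((d k).map C).mulVec (fun a => C (φ q a))
        - q • ((d k).map C).mulVec (fun a => C (φ p a)) + (pencil d).mulVec H := by
  -- For k = 0, (x × y)₀ d₁ - (x × y)₁ d₀ = y₂ (∑ xᵢ dᵢ) - x₂ (∑ yᵢ dᵢ), and the last sum dies on φ.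
  -- So b₁ contributes its row at y₂ φ to the witness; the term of b₂ arises likewise, with the
  -- opposite sign.
  refine ⟨bezoutRow (b (k + 1)) (_root_.mulShift (X (k + 2)) φ)
    - bezoutRow (b (k + 2)) (_root_.mulShift (X (k + 1)) φ), ?_⟩
  have hI : p • ((d k).map C).mulVec (fun a => C (φ q a))
        - q • ((d k).map C).mulVec (fun a => C (φ p a)) = ((d k).map C).mulVec
        (fun a => p * C (φ q a) - q * C (φ p a)) := by
    rw [← Matrix.mulVec_smul, ← Matrix.mulVec_smul, ← Matrix.mulVec_sub]
    rfl
  have h1 := h.sum_bezoutRow (b (k + 1))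
  have h2 := h.sum_bezoutRow (b (k + 2))
  rw [hI, ← hb.sum_bezoutRow φ]
  ext1 a
  replace h1 := congrFun h1 a
  replace h2 := congrFun h2 a
  simp only [bezoutVector, pencil, Fin.sum_univ_three, Matrix.mulVec_add, Matrix.mulVec_sub,
    Matrix.mulVec_smul, Matrix.add_mulVec, Matrix.smul_mulVec, Pi.add_apply, Pi.sub_apply,
    Pi.smul_apply, smul_eq_mul, Pi.zero_apply] at h1 h2 ⊢
  fin_cases k
  all_goals
    simp only [Fin.zero_eta, Fin.mk_one, Fin.reduceFinMk, Fin.isValue, Fin.reduceAdd,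
      zero_add] at h1 h2 ⊢
  · linear_combination (X 1 : MvPolynomial (Fin 3) ℂ) * h2 - X 2 * h1
  · linear_combination (X 2 : MvPolynomial (Fin 3) ℂ) * h2 - X 0 * h1
  · linear_combination (X 0 : MvPolynomial (Fin 3) ℂ) * h2 - X 1 * h1

end BezoutVector

/-! ### Restricting functionals to one degree -/

section Truncation

variable {m n : ℕ}

theorem homogeneousComponent_mul_of_isHomogeneous {σ : Type*} {g : MvPolynomial σ ℂ} {e : ℕ}
    (hg : g.IsHomogeneous e) (N : ℕ) (f : MvPolynomial σ ℂ) :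
    homogeneousComponent (N + e) (g * f) = g * homogeneousComponent N f := by
  have h : g * f = ∑ i ∈ Finset.range (f.totalDegree + 1), g * homogeneousComponent i f := by
    rw [← Finset.mul_sum, sum_homogeneousComponent]
  rw [h, map_sum]
  have h2 : ∀ i, homogeneousComponent (N + e) (g * homogeneousComponent i f)
      = if i = N then g * homogeneousComponent N f else 0 := fun i => by
    rw [homogeneousComponent_of_mem (n := i + e)
      (by simpa [add_comm] using hg.mul (homogeneousComponent_isHomogeneous i f))]
    by_cases hi : i = N
    · simp [hi]
    · rw [if_neg (by omega), if_neg hi]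
  simp only [h2, Finset.sum_ite_eq', Finset.mem_range]
  split_ifs with hN
  · rfl
  · rw [homogeneousComponent_eq_zero _ _ (by omega), mul_zero]

theorem homogeneousComponent_mul_eq_zero {σ : Type*} {g : MvPolynomial σ ℂ} {e N : ℕ}
    (hg : g.IsHomogeneous e) (hN : N < e) (f : MvPolynomial σ ℂ) :
    homogeneousComponent N (g * f) = 0 := by
  have h : g * f = ∑ i ∈ Finset.range (f.totalDegree + 1), g * homogeneousComponent i f := by
    rw [← Finset.mul_sum, sum_homogeneousComponent]
  rw [h, map_sum]
  refine Finset.sum_eq_zero fun i _ => ?_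
  rw [homogeneousComponent_of_mem (n := i + e)
      (by simpa [add_comm] using hg.mul (homogeneousComponent_isHomogeneous i f)),
    if_neg (by omega)]

/-- `φ` only depends on the component of degree `N`. -/
def IsOfDegree (N : ℕ) (φ : MvPolynomial (Fin 3) ℂ →ₗ[ℂ] (Fin m → ℂ)) : Prop :=
  ∀ f, φ (homogeneousComponent N f) = φ f

theorem IsOfDegree.eq_zero {N e : ℕ} {φ : MvPolynomial (Fin 3) ℂ →ₗ[ℂ] (Fin m → ℂ)}
    (h : IsOfDegree N φ) {f : MvPolynomial (Fin 3) ℂ} (hf : f.IsHomogeneous e) (he : N ≠ e) :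
    φ f = 0 := by
  rw [← h f, homogeneousComponent_of_mem (n := e) hf, if_neg he, map_zero]

theorem isOfDegree_comp (N : ℕ) (φ : MvPolynomial (Fin 3) ℂ →ₗ[ℂ] (Fin m → ℂ)) :
    IsOfDegree N (φ ∘ₗ homogeneousComponent N) := fun f => by
  simp only [LinearMap.comp_apply]
  rw [homogeneousComponent_eq_self (homogeneousComponent_isHomogeneous N f)]

theorem IsPrincipal.comp_homogeneousComponent {d : Fin 3 → Matrix (Fin m) (Fin m) ℂ}
    {φ : MvPolynomial (Fin 3) ℂ →ₗ[ℂ] (Fin m → ℂ)} (h : IsPrincipal d φ) (N : ℕ) :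
    IsPrincipal d (φ ∘ₗ homogeneousComponent N) := fun f => by
  simp only [LinearMap.comp_apply]
  cases N with
  | zero => simp [homogeneousComponent_mul_eq_zero (isHomogeneous_X ℂ _) Nat.zero_lt_one]
  | succ N =>
    simpa only [homogeneousComponent_mul_of_isHomogeneous (isHomogeneous_X ℂ _)] using h _

theorem mulShift_comp_homogeneousComponent {g : MvPolynomial (Fin 3) ℂ} {e : ℕ}
    (hg : g.IsHomogeneous e) (N : ℕ) (φ : MvPolynomial (Fin 3) ℂ →ₗ[ℂ] (Fin m → ℂ)) :
    mulShift g (φ ∘ₗ homogeneousComponent (N + e)) = mulShift g φ ∘ₗ homogeneousComponent N := by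
  refine LinearMap.ext fun f => ?_
  simp [homogeneousComponent_mul_of_isHomogeneous hg]

theorem mulShift_comp_homogeneousComponent_eq_zero {g : MvPolynomial (Fin 3) ℂ} {e : ℕ}
    (hg : g.IsHomogeneous e) (N : ℕ) {φ : MvPolynomial (Fin 3) ℂ →ₗ[ℂ] (Fin m → ℂ)}
    (h : mulShift g φ = 0) : mulShift g (φ ∘ₗ homogeneousComponent N) = 0 := by
  rcases lt_or_ge N e with hN | hN
  · refine LinearMap.ext fun f => ?_
    simp [homogeneousComponent_mul_eq_zero hg hN]
  · obtain ⟨M, rfl⟩ := Nat.exists_eq_add_of_le' hN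
    rw [mulShift_comp_homogeneousComponent hg, h, LinearMap.zero_comp]

theorem MonomialIndex.isHomogeneous_toPoly (i : MonomialIndex n) :
    i.toPoly.IsHomogeneous (n - 1) := by
  refine isHomogeneous_monomial _ ?_
  have := i.2
  rw [Finsupp.degree_eq_sum]
  simp only [Finsupp.equivFunOnFinite_symm_apply_apply]
  omega

theorem bezoutVector_eq_zero {φ : MvPolynomial (Fin 3) ℂ →ₗ[ℂ] (Fin m → ℂ)}
    (h : ∀ j : MonomialIndex n, φ j.toPoly = 0) (d : Fin 3 → Matrix (Fin m) (Fin m) ℂ)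
    (b : Fin 3 → Matrix (MonomialIndex n) (MonomialIndex n) ℂ) : bezoutVector d b φ = 0 := by
  have h0 : ∀ k, bezoutRow (b k) φ = 0 := fun k => funext fun a => by simp [bezoutRow, h]
  simp [bezoutVector, h0]

end Truncation

/-! ### Dividing a kernel functional by a linear form -/

section Step

variable {m n : ℕ}

theorem map_eval_pencil (d : Fin 3 → Matrix (Fin m) (Fin m) ℂ) (x : Fin 3 → ℂ) :
    (pencil d).map (eval x) = ∑ k, x k • d k := by
  ext a b
  simp [pencil, Matrix.sum_apply]

/-- A polynomial regular modulo `ℓ` on the cokernel of a pencil does not kill constants. -/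
theorem eq_zero_of_smul_C_eq {d : Fin 3 → Matrix (Fin m) (Fin m) ℂ}
    {ℓ q : MvPolynomial (Fin 3) ℂ} (hℓ0 : eval 0 ℓ = 0)
    (hq : ∀ F G H, q • F = ℓ • G + (pencil d).mulVec H →
      ∃ G' H', F = ℓ • G' + (pencil d).mulVec H')
    {ξ : Fin m → ℂ} {G H : Fin m → MvPolynomial (Fin 3) ℂ}
    (h : q • (fun a => C (ξ a)) = ℓ • G + (pencil d).mulVec H) : ξ = 0 := by
  -- Regularity puts the constant vector ξ into ℓ Sᵐ + A Sᵐ, all of whose elements vanish at the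
  -- origin.
  obtain ⟨G', H', e⟩ := hq _ _ _ h
  ext a
  have e1 := congrArg (eval 0) (congrFun e a)
  have e2 : eval 0 ((pencil d).mulVec H' a) = 0 := by
    have h0 : ∀ b, eval 0 (pencil d a b) = 0 := fun b => by
      have := congrFun (congrFun (map_eval_pencil d 0) a) b
      simpa using this
    rw [Matrix.mulVec, dotProduct, map_sum]
    exact Finset.sum_eq_zero fun b _ => by rw [map_mul, h0, zero_mul]
  rwa [Pi.add_apply, Pi.smul_apply, smul_eq_mul, map_add, map_mul, hℓ0, e2, zero_mul, add_zero,
    eval_C] at e1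

theorem map_C_mulVec (A : Matrix (Fin m) (Fin m) ℂ) (ξ : Fin m → ℂ) :
    (A.map C).mulVec (fun a => (C (ξ a) : MvPolynomial (Fin 3) ℂ))
      = fun a => C (A.mulVec ξ a) := by
  ext1 a
  simp [Matrix.mulVec, dotProduct]

/-- Functionals that satisfy the relations of the principal subspace, are killed by `p` and `q`,
and all of whose shifts have their Bezout vector in the image of the pencil. -/
structure IsBezoutKernel (d : Fin 3 → Matrix (Fin m) (Fin m) ℂ)
    (b : Fin 3 → Matrix (MonomialIndex n) (MonomialIndex n) ℂ) (p q : MvPolynomial (Fin 3) ℂ)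
    (φ : MvPolynomial (Fin 3) ℂ →ₗ[ℂ] (Fin m → ℂ)) : Prop where
  principal : IsPrincipal d φ
  left : mulShift p φ = 0
  right : mulShift q φ = 0
  mem : ∀ f, bezoutVector d b (mulShift f φ) ∈ LinearMap.range (pencil d).mulVecLin

/-- Write Kₖ for the Bezout vector of xₖ ρ. Modulo the image of the pencil, K₀ ≡ s K₁, and the three
relations give ℓ K₁ ≡ -q d₂ ρ(p) and ℓ K₂ ≡ q (d₁ + s d₀) ρ(p). Since q does not kill nonzero
constants modulo ℓ, both constant vectors vanish; hence so does (s d₀ + d₁ + t d₂) ρ(p), and ρ(p) =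
0. Now ℓ K₁ ≡ ℓ K₂ ≡ 0, and ℓ cancels. -/
theorem IsPrincipal.mem_range_of_mulShift {d : Fin 3 → Matrix (Fin m) (Fin m) ℂ}
    {b : Fin 3 → Matrix (MonomialIndex n) (MonomialIndex n) ℂ}
    {p q ℓ : MvPolynomial (Fin 3) ℂ} (hb : BezoutIdentity b p q)
    {s t : ℂ} (hℓ : ℓ = X 0 - C s * X 1)
    (hdet : (s • d 0 + d 1 + t • d 2).det ≠ 0)
    (h1 : ∀ F H, ℓ • F = (pencil d).mulVec H → ∃ G, F = (pencil d).mulVec G)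
    (h2 : ∀ F G H, q • F = ℓ • G + (pencil d).mulVec H →
      ∃ G' H', F = ℓ • G' + (pencil d).mulVec H')
    {ρ : MvPolynomial (Fin 3) ℂ →ₗ[ℂ] (Fin m → ℂ)} (hρ : IsPrincipal d ρ) (hρq : ρ q = 0)
    (hmem : bezoutVector d b (_root_.mulShift ℓ ρ) ∈ LinearMap.range (pencil d).mulVecLin) :
    ρ p = 0 ∧
      ∀ k, bezoutVector d b (_root_.mulShift (X k) ρ) ∈ LinearMap.range (pencil d).mulVecLin := by
  obtain ⟨H, hH⟩ := hmem
  obtain ⟨H0, r0⟩ := hρ.bezoutVector_relation hb 0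
  obtain ⟨H1, r1⟩ := hρ.bezoutVector_relation hb 1
  obtain ⟨H2, r2⟩ := hρ.bezoutVector_relation hb 2
  have hs : _root_.mulShift ℓ ρ
      = _root_.mulShift (X 0) ρ + (-s) • _root_.mulShift (X 1) ρ := by
    refine LinearMap.ext fun f => ?_
    rw [mulShift_apply, hℓ, sub_mul, map_sub, mul_assoc, ← smul_eq_C_mul, map_smul]
    simp [sub_eq_add_neg]
  rw [hs, bezoutVector_add, bezoutVector_smul] at hH
  have hz : (fun a => C (ρ q a) : Fin m → MvPolynomial (Fin 3) ℂ) = 0 := by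
    ext1 a; simp [hρq]
  simp only [hz, Matrix.mulVec_zero, smul_zero, zero_sub, map_C_mulVec, Fin.isValue,
    Fin.reduceAdd, zero_add, Matrix.mulVecLin_apply] at r0 r1 r2 hH
  have hℓ0 : eval 0 ℓ = 0 := by simp [hℓ]
  set K0 := bezoutVector d b (_root_.mulShift (X 0) ρ) with hK0
  set K1 := bezoutVector d b (_root_.mulShift (X 1) ρ) with hK1
  set K2 := bezoutVector d b (_root_.mulShift (X 2) ρ) with hK2
  have e1 : ℓ • K1 = (pencil d).mulVec (H2 + (X 1 : MvPolynomial (Fin 3) ℂ) • H)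
      - q • fun a => C ((d 2).mulVec (ρ p) a) := by
    rw [Matrix.mulVec_add, Matrix.mulVec_smul, hH]
    ext1 a
    have := congrFun r2 a
    simp only [Pi.add_apply, Pi.sub_apply, Pi.smul_apply, smul_eq_mul, Pi.neg_apply, C_neg,
      hℓ] at this ⊢
    linear_combination this
  have e2 : ℓ • K2 = q • (fun a => C ((d 1 + s • d 0).mulVec (ρ p) a))
      + (pencil d).mulVec ((X 2 : MvPolynomial (Fin 3) ℂ) • H - H1
        - (C s : MvPolynomial (Fin 3) ℂ) • H0) := by
    rw [Matrix.mulVec_sub, Matrix.mulVec_sub, Matrix.mulVec_smul, Matrix.mulVec_smul, hH]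
    ext1 a
    have t0 := congrFun r0 a
    have t1 := congrFun r1 a
    simp only [Pi.add_apply, Pi.sub_apply, Pi.smul_apply, smul_eq_mul, Pi.neg_apply, C_neg,
      hℓ, Matrix.add_mulVec, Matrix.smul_mulVec, C_add, C_mul] at t0 t1 ⊢
    linear_combination -t1 - C s * t0
  have z1 : (d 2).mulVec (ρ p) = 0 :=
    eq_zero_of_smul_C_eq hℓ0 h2 (G := -K1)
      (H := H2 + (X 1 : MvPolynomial (Fin 3) ℂ) • H) (by rw [smul_neg, e1]; abel)
  have z2 : (d 1 + s • d 0).mulVec (ρ p) = 0 :=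
    eq_zero_of_smul_C_eq hℓ0 h2 (G := K2)
      (H := -((X 2 : MvPolynomial (Fin 3) ℂ) • H - H1
        - (C s : MvPolynomial (Fin 3) ℂ) • H0)) (by rw [e2, Matrix.mulVec_neg]; abel)
  have hρp : ρ p = 0 := by
    refine Matrix.eq_zero_of_mulVec_eq_zero hdet ?_
    rw [Matrix.add_mulVec, Matrix.smul_mulVec, z1, smul_zero, add_zero, add_comm, z2]
  have m1 : K1 ∈ LinearMap.range (pencil d).mulVecLin := by
    obtain ⟨G, hG⟩ := h1 K1 (H2 + (X 1 : MvPolynomial (Fin 3) ℂ) • H) (by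
      rw [e1, z1]; simp [← Pi.zero_def])
    exact ⟨G, hG.symm⟩
  have m2 : K2 ∈ LinearMap.range (pencil d).mulVecLin := by
    obtain ⟨G, hG⟩ := h1 K2 _ (by rw [e2, z2]; simp [← Pi.zero_def]; rfl)
    exact ⟨G, hG.symm⟩
  have m0 : K0 ∈ LinearMap.range (pencil d).mulVecLin := by
    have : K0 = (pencil d).mulVecLin H + (C s : MvPolynomial (Fin 3) ℂ) • K1 := by
      rw [Matrix.mulVecLin_apply, hH, C_neg, neg_smul]; abel
    rw [this]
    exact Submodule.add_mem _ ⟨H, rfl⟩ (Submodule.smul_mem _ _ m1)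
  refine ⟨hρp, fun k => ?_⟩
  fin_cases k
  · exact m0
  · exact m1
  · exact m2

/-- Regularity on the transposed cokernel provides φ'. The previous lemma applies to every shift ρ =
f φ', because ℓ ρ = f φ already has its Bezout vector in the image; this yields p φ' = 0 and all
shifts by multiples of a variable. -/
theorem IsBezoutKernel.exists_mulShift_eq {d : Fin 3 → Matrix (Fin m) (Fin m) ℂ}
    {b : Fin 3 → Matrix (MonomialIndex n) (MonomialIndex n) ℂ}
    {p q ℓ : MvPolynomial (Fin 3) ℂ} (hq : q.IsHomogeneous n) (hb : BezoutIdentity b p q)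
    {s t : ℂ} (hℓ : ℓ = X 0 - C s * X 1)
    (hdet : (s • d 0 + d 1 + t • d 2).det ≠ 0)
    (h1 : ∀ F H, ℓ • F = (pencil d).mulVec H → ∃ G, F = (pencil d).mulVec G)
    (h2 : ∀ F G H, q • F = ℓ • G + (pencil d).mulVec H →
      ∃ G' H', F = ℓ • G' + (pencil d).mulVec H')
    (h3 : ∀ F H, ℓ • F = (pencil d).transpose.mulVec H →
      ∃ G, F = (pencil d).transpose.mulVec G)
    (h4 : ∀ F G H, q • F = ℓ • G + (pencil d).transpose.mulVec H →
      ∃ G' H', F = ℓ • G' + (pencil d).transpose.mulVec H')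
    {φ : MvPolynomial (Fin 3) ℂ →ₗ[ℂ] (Fin m → ℂ)} (hφ : IsBezoutKernel d b p q φ)
    {N : ℕ} (hN : n ≤ N + 1) (hφN : IsOfDegree N φ) :
    ∃ φ', IsBezoutKernel d b p q φ' ∧ IsOfDegree (N + 1) φ' ∧ mulShift ℓ φ' = φ := by
  have hℓ1 : ℓ.IsHomogeneous 1 := by
    rw [hℓ]
    exact (isHomogeneous_X ℂ _).sub (by
      simpa using (isHomogeneous_C (Fin 3) s).mul (isHomogeneous_X ℂ (1 : Fin 3)))
  obtain ⟨φ₀, k1, k2, k3⟩ := hφ.principal.exists_mulShift_eq h3 h4 hφ.right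
  set φ' := φ₀ ∘ₗ homogeneousComponent (N + 1) with hφ'
  have g1 : IsPrincipal d φ' := k1.comp_homogeneousComponent _
  have g2 : mulShift ℓ φ' = φ := by
    rw [hφ', mulShift_comp_homogeneousComponent hℓ1, k2]
    exact LinearMap.ext hφN
  have g3 : mulShift q φ' = 0 := mulShift_comp_homogeneousComponent_eq_zero hq _ k3
  have key : ∀ f, mulShift f φ' p = 0 ∧ ∀ k,
      bezoutVector d b (mulShift (X k) (mulShift f φ'))
        ∈ LinearMap.range (pencil d).mulVecLin := fun f => by
    refine (g1.mulShift f).mem_range_of_mulShift hb hℓ hdet h1 h2 ?_ ?_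
    · rw [mulShift_apply, mul_comm]
      exact DFunLike.congr_fun g3 f
    · rw [mulShift_mul, mul_comm, ← mulShift_mul, g2]
      exact hφ.mem f
  have hdeg := isOfDegree_comp (N + 1) φ₀
  refine ⟨φ', ⟨g1, LinearMap.ext fun f => ?_, g3, fun f => ?_⟩, hdeg, g2⟩
  · rw [mulShift_apply, mul_comm]
    exact (key f).1
  · induction f using MvPolynomial.induction_on with
    | C c =>
      -- Constants remain: φ' lives in degree N + 1 > n - 1, so it vanishes at all monomials that
      -- enter the Bezout vector.
      rw [mulShift_C, bezoutVector_smul, bezoutVector_eq_zero fun j => hdeg.eq_zero j.isHomogeneous_toPoly (by omega),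
        smul_zero]
      exact Submodule.zero_mem _
    | add f g hf hg =>
      rw [mulShift_add, bezoutVector_add]
      exact Submodule.add_mem _ hf hg
    | mul_X f k _ =>
      rw [mul_comm, ← mulShift_mul]
      exact (key f).2 k

end Step

/-! ### No common zero implies trivial kernel -/

section Injectivity

variable {m n : ℕ}

theorem eval_det_pencil (d : Fin 3 → Matrix (Fin m) (Fin m) ℂ) (x : Fin 3 → ℂ) :
    eval x (pencil d).det = (∑ k, x k • d k).det := by
  rw [RingHom.map_det, ← map_eval_pencil]
  rfl

/-- The determinant annihilates the cokernel, by the adjugate formula. -/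
theorem IsPrincipal.apply_det_mul {d : Fin 3 → Matrix (Fin m) (Fin m) ℂ}
    {φ : MvPolynomial (Fin 3) ℂ →ₗ[ℂ] (Fin m → ℂ)} (h : IsPrincipal d φ)
    (f : MvPolynomial (Fin 3) ℂ) : φ ((pencil d).det * f) = 0 := by
  ext a
  have := h.toFunctional_eq_zero ((pencil d).transpose.adjugate.mulVec (Pi.single a f))
  rw [Matrix.mulVec_mulVec, Matrix.mul_adjugate, Matrix.det_transpose, Matrix.smul_mulVec,
    Matrix.one_mulVec, ← Pi.single_smul, toFunctional_apply, Finset.sum_eq_single a] at this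
  · simpa using this
  · intro c _ hc
    simp [Pi.single_eq_of_ne hc]
  · simp

theorem IsPrincipal.isBezoutKernel {d : Fin 3 → Matrix (Fin m) (Fin m) ℂ}
    {b : Fin 3 → Matrix (MonomialIndex n) (MonomialIndex n) ℂ}
    {p q : MvPolynomial (Fin 3) ℂ} (hn : 1 ≤ n) (hp : p.IsHomogeneous n) (hq : q.IsHomogeneous n)
    {φ : MvPolynomial (Fin 3) ℂ →ₗ[ℂ] (Fin m → ℂ)} (hφ : IsPrincipal d φ)
    (hdeg : IsOfDegree (n - 1) φ)
    (hmem : bezoutVector d b φ ∈ LinearMap.range (pencil d).mulVecLin) :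
    IsBezoutKernel d b p q φ := by
  have h0 : ∀ {g : MvPolynomial (Fin 3) ℂ}, g.IsHomogeneous n → ∀ f, φ (g * f) = 0 := by
    intro g hg f
    rw [← hdeg, homogeneousComponent_mul_eq_zero hg (by omega), map_zero]
  refine ⟨hφ, LinearMap.ext (h0 hp), LinearMap.ext (h0 hq), fun f => ?_⟩
  induction f using MvPolynomial.induction_on with
  | C c =>
    rw [mulShift_C, bezoutVector_smul]
    exact Submodule.smul_mem _ _ hmem
  | add f g hf hg =>
    rw [mulShift_add, bezoutVector_add]
    exact Submodule.add_mem _ hf hg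
  | mul_X f k _ =>
    -- A variable times a monomial of degree n - 1 has degree n, where φ vanishes.
    rw [bezoutVector_eq_zero fun j => ?_]
    · exact Submodule.zero_mem _
    · rw [mulShift_apply, mul_assoc, mul_comm]
      refine h0 ?_ f
      have := (isHomogeneous_X ℂ k).mul j.isHomogeneous_toPoly
      rwa [Nat.add_sub_cancel' hn] at this

/-- If `q` has no zero on the curve and a line through a point off the curve, and `p` and `q` have
no common zero on the curve, then the Bezoutian along the curve has no kernel. -/
theorem IsPrincipal.eq_zero_of_line {d : Fin 3 → Matrix (Fin m) (Fin m) ℂ}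
    {b : Fin 3 → Matrix (MonomialIndex n) (MonomialIndex n) ℂ}
    {p q : MvPolynomial (Fin 3) ℂ} (hn : 1 ≤ n) (hp : p.IsHomogeneous n) (hq : q.IsHomogeneous n)
    (hb : BezoutIdentity b p q) {s t : ℂ} (hdet : (s • d 0 + d 1 + t • d 2).det ≠ 0)
    (hline : ∀ x, x 0 = s * x 1 → eval x (pencil d).det = 0 → eval x q = 0 → x = 0)
    (hcurve : ∀ x, eval x (pencil d).det = 0 → eval x p = 0 → eval x q = 0 → x = 0)
    {φ : MvPolynomial (Fin 3) ℂ →ₗ[ℂ] (Fin m → ℂ)} (hφ : IsPrincipal d φ)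
    (hdeg : IsOfDegree (n - 1) φ)
    (hmem : bezoutVector d b φ ∈ LinearMap.range (pencil d).mulVecLin) : φ = 0 := by
  set ℓ : MvPolynomial (Fin 3) ℂ := X 0 - C s * X 1 with hℓ
  set μ : MvPolynomial (Fin 3) ℂ := X 2 - C t * X 1 with hμ
  have hc : eval ![s, 1, t] (pencil d).det ≠ 0 := by
    rw [eval_det_pencil]
    simpa [Fin.sum_univ_three] using hdet
  have hprime : Prime ℓ := prime_X_sub_C_mul_X (by decide) s
  have hP : (Ideal.span {ℓ, μ}).IsPrime := isPrime_span_pair s t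
  have a1 : ¬ ℓ ∣ (pencil d).det := fun ⟨g, hg⟩ => hc (by rw [hg]; simp [hℓ])
  have a2 : (pencil d).det ∉ Ideal.span {ℓ, μ} := fun h => by
    obtain ⟨u, w, hg⟩ := Ideal.mem_span_pair.1 h
    exact hc (by rw [← hg]; simp [hℓ, hμ])
  have a3 : ¬ ℓ ∣ μ := fun ⟨g, hg⟩ => by
    have := congrArg (eval ![s, 1, t + 1]) hg
    simp [hℓ, hμ] at this
  obtain ⟨r, hr⟩ : ∃ r, μ ^ r ∈ Ideal.span {q, (pencil d).det, ℓ} :=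
    -- The common zeros reduce to the origin, where μ vanishes too; the same argument below treats
    -- ℓ.
    exists_pow_mem_span_of_eval fun x hx => by
      have h1 := hx ℓ (by simp)
      rw [hline x (by simpa [hℓ, sub_eq_zero] using h1) (hx _ (by simp)) (hx _ (by simp))]
      simp [hμ]
  obtain ⟨e, he⟩ : ∃ e, ℓ ^ e ∈ Ideal.span {p, q, (pencil d).det} :=
    exists_pow_mem_span_of_eval fun x hx => by
      rw [hcurve x (hx _ (by simp)) (hx _ (by simp)) (hx _ (by simp))]
      simp [hℓ]
  have hstep : ∀ k, ∃ φ', IsBezoutKernel d b p q φ' ∧ IsOfDegree (n - 1 + k) φ' ∧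
      _root_.mulShift (ℓ ^ k) φ' = φ := by
    intro k
    induction k with
    | zero =>
      exact ⟨φ, hφ.isBezoutKernel hn hp hq hdeg hmem, hdeg, LinearMap.ext fun f => by simp⟩
    | succ k ih =>
      obtain ⟨φ', h1, h2, h3⟩ := ih
      obtain ⟨φ'', g1, g2, g3⟩ := h1.exists_mulShift_eq hq hb hℓ hdet
        (fun F H h => exists_eq_mulVec_of_prime_smul hprime a1 h)
        (fun F G H h => exists_eq_smul_add_mulVec_of_pow_mem hprime a3 hP a2 hr h)
        (fun F H h => exists_eq_mulVec_of_prime_smul hprime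
          (by rwa [Matrix.det_transpose]) h)
        (fun F G H h => exists_eq_smul_add_mulVec_of_pow_mem hprime a3 hP
          (by rwa [Matrix.det_transpose]) (by rwa [Matrix.det_transpose]) h)
        (by omega) h2
      exact ⟨φ'', g1, g2, by rw [pow_succ, ← mulShift_mul, g3, h3]⟩
  obtain ⟨φ', h1, -, h3⟩ := hstep e
  obtain ⟨u, z, hz, hs⟩ := Ideal.mem_span_insert.1 he
  obtain ⟨v, w, hs'⟩ := Ideal.mem_span_pair.1 hz
  refine LinearMap.ext fun f => ?_
  have e1 : φ' (p * (u * f)) = 0 := DFunLike.congr_fun h1.left (u * f)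
  have e2 : φ' (q * (v * f)) = 0 := DFunLike.congr_fun h1.right (v * f)
  have e3 := h1.principal.apply_det_mul (w * f)
  rw [← h3, mulShift_apply, hs, ← hs', show (u * p + (v * q + w * (pencil d).det)) * f
    = p * (u * f) + q * (v * f) + (pencil d).det * (w * f) by ring, map_add, map_add, e1, e2, e3]
  simp

theorem exists_det_ne_zero {d : Fin 3 → Matrix (Fin m) (Fin m) ℂ} (hd : (pencil d).det ≠ 0) :
    ∃ s t : ℂ, (s • d 0 + d 1 + t • d 2).det ≠ 0 := by
  -- The factor `X 1` forces x₁ ≠ 0, so that the point can be scaled to (s, 1, t).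
  obtain ⟨x, hx⟩ : ∃ x, eval x ((pencil d).det * X 1) ≠ 0 := by
    by_contra! h
    exact mul_ne_zero hd (X_ne_zero 1) (MvPolynomial.funext fun x => by rw [h x, map_zero])
  rw [map_mul, eval_X, mul_ne_zero_iff, eval_det_pencil] at hx
  refine ⟨x 0 / x 1, x 2 / x 1, fun h => hx.1 ?_⟩
  have : ∑ k, x k • d k = x 1 • ((x 0 / x 1) • d 0 + d 1 + (x 2 / x 1) • d 2) := by
    rw [Fin.sum_univ_three, smul_add, smul_add, smul_smul, smul_smul, mul_div_cancel₀ _ hx.2,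
      mul_div_cancel₀ _ hx.2]
  rw [this, Matrix.det_smul, h, mul_zero]

theorem eval_smul_of_isHomogeneous {σ : Type*} [Fintype σ] {f : MvPolynomial σ ℂ} {e : ℕ}
    (hf : f.IsHomogeneous e) (c : ℂ) (x : σ → ℂ) :
    eval (c • x) f = c ^ e * eval x f := by
  rw [eval_eq', eval_eq', Finset.mul_sum]
  refine Finset.sum_congr rfl fun d hd => ?_
  have h : ∑ i, d i = e := by
    rw [← Finsupp.degree_eq_sum, Finsupp.degree_eq_weight_one]
    exact hf (mem_support_iff.1 hd)
  simp only [Pi.smul_apply, smul_eq_mul, mul_pow, Finset.prod_mul_distrib,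
    Finset.prod_pow_eq_pow_sum, h]
  ring

/-- The line is not contained in the curve, so it meets it in finitely many points: roots r of P
give (s, 1, r), and (0, 0, 1) may be one more. Each excludes at most one c. -/
theorem exists_line_combination {d : Fin 3 → Matrix (Fin m) (Fin m) ℂ} {p q : MvPolynomial (Fin 3) ℂ}
    (hp : p.IsHomogeneous n) (hq : q.IsHomogeneous n)
    {s t : ℂ} (hdet : (s • d 0 + d 1 + t • d 2).det ≠ 0)
    (hcurve : ∀ x, eval x (pencil d).det = 0 → eval x p = 0 → eval x q = 0 → x = 0) :
    ∃ c : ℂ, ∀ x, x 0 = s * x 1 → eval x (pencil d).det = 0 →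
      eval x (p + C c * q) = 0 → x = 0 := by
  let P : Polynomial ℂ := aeval ![Polynomial.C s, 1, Polynomial.X] (pencil d).det
  have hP : ∀ r, P.eval r = eval ![s, 1, r] (pencil d).det := fun r => by
    have : (Polynomial.evalRingHom r).comp
        (aeval ![Polynomial.C s, 1, Polynomial.X] : MvPolynomial (Fin 3) ℂ →ₐ[ℂ] _).toRingHom
        = eval ![s, 1, r] := by
      refine MvPolynomial.ringHom_ext (fun a => by simp) (fun i => ?_)
      fin_cases i <;> simp
    exact DFunLike.congr_fun this _
  have hP0 : P ≠ 0 := fun h => hdet (by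
    have := hP t
    rw [h, eval_det_pencil] at this
    simpa [Fin.sum_univ_three] using this.symm)
  have hdetsmul : ∀ (u : ℂ) (x : Fin 3 → ℂ), eval (u • x) (pencil d).det
      = u ^ m * eval x (pencil d).det := fun u x => by
    simp only [eval_det_pencil, Pi.smul_apply, smul_eq_mul, mul_smul, ← Finset.smul_sum,
      Matrix.det_smul, Fintype.card_fin]
  -- Where q vanishes this is the default value 0, which is harmless: there p + c q = p ≠ 0 on the
  -- curve for every c.
  let bad : (Fin 3 → ℂ) → ℂ := fun x => -(eval x p / eval x q)
  obtain ⟨c, hc⟩ := Infinite.exists_notMem_finset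
    (insert (bad ![0, 0, 1]) (P.roots.toFinset.image fun r => bad ![s, 1, r]))
  simp only [Finset.mem_insert, Finset.mem_image, Multiset.mem_toFinset, not_or, not_exists,
    not_and] at hc
  have hne : ∀ x, x ≠ 0 → eval x (pencil d).det = 0 → c ≠ bad x → eval x (p + C c * q) ≠ 0 := by
    intro x hx h1 h2 h3
    simp only [map_add, map_mul, eval_C] at h3
    by_cases h4 : eval x q = 0
    · exact hx (hcurve x h1 (by simpa [h4] using h3) h4)
    · exact h2 (by simp only [bad]; field_simp; linear_combination h3)
  have hpq : (p + C c * q).IsHomogeneous n :=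
    hp.add (by simpa using (isHomogeneous_C (Fin 3) c).mul hq)
  have hscale : ∀ (u : ℂ) (y : Fin 3 → ℂ), u ≠ 0 → y ≠ 0 →
      (eval y (pencil d).det = 0 → c ≠ bad y) → eval (u • y) (pencil d).det = 0 →
      eval (u • y) (p + C c * q) ≠ 0 := by
    intro u y hu hy h1 h2
    rw [hdetsmul, mul_eq_zero, or_iff_right (pow_ne_zero _ hu)] at h2
    rw [eval_smul_of_isHomogeneous hpq]
    exact mul_ne_zero (pow_ne_zero _ hu) (hne y hy h2 (h1 h2))
  refine ⟨c, fun x hx h1 h2 => ?_⟩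
  by_cases hu : x 1 = 0
  · by_contra hx0
    have hv : x 2 ≠ 0 := fun hv => hx0 (by ext i; fin_cases i <;> simp [hx, hu, hv])
    have hxe : x = x 2 • ![0, 0, 1] := by ext i; fin_cases i <;> simp [hx, hu]
    rw [hxe] at h1 h2
    exact hscale _ _ hv (fun h => by simpa using congrFun h 2) (fun _ => hc.1) h1 h2
  · exfalso
    have hxe : x = x 1 • ![s, 1, x 2 / x 1] := by
      ext i; fin_cases i <;> simp [hx, mul_comm, mul_div_cancel₀ _ hu]
    rw [hxe] at h1 h2
    refine hscale _ _ hu (fun h => by simpa using congrFun h 1) (fun h => ?_) h1 h2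
    refine fun h' => hc.2 _ ?_ h'.symm
    rw [Polynomial.mem_roots hP0, Polynomial.IsRoot.def, hP, h]

/-- If `p` and `q` have no common zero on the curve, then the Bezoutian along the curve has no
kernel. -/
theorem IsPrincipal.eq_zero {d : Fin 3 → Matrix (Fin m) (Fin m) ℂ}
    {b : Fin 3 → Matrix (MonomialIndex n) (MonomialIndex n) ℂ}
    {p q : MvPolynomial (Fin 3) ℂ} (hn : 1 ≤ n) (hp : p.IsHomogeneous n) (hq : q.IsHomogeneous n)
    (hb : BezoutIdentity b p q) (hd : (pencil d).det ≠ 0)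
    (hcurve : ∀ x, eval x (pencil d).det = 0 → eval x p = 0 → eval x q = 0 → x = 0)
    {φ : MvPolynomial (Fin 3) ℂ →ₗ[ℂ] (Fin m → ℂ)} (hφ : IsPrincipal d φ)
    (hdeg : IsOfDegree (n - 1) φ)
    (hmem : bezoutVector d b φ ∈ LinearMap.range (pencil d).mulVecLin) : φ = 0 := by
  obtain ⟨s, t, hdet⟩ := exists_det_ne_zero hd
  obtain ⟨c, hc⟩ := exists_line_combination hp hq hdet hcurve
  -- This substitution has determinant 1, so p(x) q(y) - q(x) p(y), and with it b, is unchanged.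
  refine hφ.eq_zero_of_line (p := -q) (q := p + C c * q) hn hq.neg
    (hp.add (by simpa using (isHomogeneous_C (Fin 3) c).mul hq)) (fun x y => ?_) hdet hc
    (fun x h1 h2 h3 => ?_) hdeg hmem
  · rw [← hb x y]
    simp only [map_neg, map_add, map_mul, eval_C]
    ring
  · rw [map_neg, neg_eq_zero] at h2
    exact hcurve x h1 (by simpa [h2] using h3) h2

end Injectivity

/-! ### Existence of symmetric Bezout coefficients -/

section Existence

/-- The bihomogeneous functions of bidegree `(n + 1, n + 1)` spanned by the `f(x) (x × y)ₖ g(y)`. -/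
def wedgeSpan (n : ℕ) : Submodule ℂ ((Fin 3 → ℂ) → (Fin 3 → ℂ) → ℂ) :=
  Submodule.span ℂ {H | ∃ (f g : MvPolynomial (Fin 3) ℂ) (k : Fin 3), f.IsHomogeneous n ∧
    g.IsHomogeneous n ∧ H = fun x y =>
      (x (k + 1) * y (k + 2) - x (k + 2) * y (k + 1)) * (eval x f * eval y g)}

theorem eval_eq_sum_monomialIndex {n : ℕ} {f : MvPolynomial (Fin 3) ℂ} (hf : f.IsHomogeneous n)
    (x : Fin 3 → ℂ) :
    eval x f = ∑ i : MonomialIndex (n + 1),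
      coeff (Finsupp.equivFunOnFinite.symm i.1) f * i.eval x := by
  rw [eval_eq']
  symm
  refine Finset.sum_bij_ne_zero (fun i _ _ => Finsupp.equivFunOnFinite.symm i.1)
    (fun i _ hi => mem_support_iff.2 (left_ne_zero_of_mul hi))
    (fun i _ _ j _ _ h => Subtype.ext (Finsupp.equivFunOnFinite.symm.injective h))
    (fun s hs hs0 => ?_) (fun i _ _ => by simp [MonomialIndex.eval])
  have h : ∑ i, s i = n := by
    rw [← Finsupp.degree_eq_sum, Finsupp.degree_eq_weight_one]
    exact hf (mem_support_iff.1 hs)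
  refine ⟨⟨s, by rw [h]⟩, Finset.mem_univ _, ?_, by ext; simp⟩
  have : Finsupp.equivFunOnFinite.symm (s : Fin 3 → ℕ) = s := by ext; simp
  simpa only [this, MonomialIndex.eval] using hs0

theorem exists_coefficients_of_mem_wedgeSpan {n : ℕ} {H : (Fin 3 → ℂ) → (Fin 3 → ℂ) → ℂ}
    (h : H ∈ wedgeSpan n) :
    ∃ b : Fin 3 → Matrix (MonomialIndex (n + 1)) (MonomialIndex (n + 1)) ℂ, ∀ x y,
      H x y = ∑ k, (x (k + 1) * y (k + 2) - x (k + 2) * y (k + 1))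
        * ∑ i, ∑ j, b k i j * MonomialIndex.eval i x * MonomialIndex.eval j y := by
  induction h using Submodule.span_induction with
  | mem H h =>
    obtain ⟨f, g, k, hf, hg, rfl⟩ := h
    refine ⟨fun l => Matrix.of fun i j => if l = k then
      coeff (Finsupp.equivFunOnFinite.symm i.1) f * coeff (Finsupp.equivFunOnFinite.symm j.1) g
      else 0, fun x y => ?_⟩
    rw [Finset.sum_eq_single k (fun l _ hl => by simp [hl]) (by simp)]
    beta_reduce
    rw [eval_eq_sum_monomialIndex hf, eval_eq_sum_monomialIndex hg, Finset.sum_mul_sum]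
    congr 1
    refine Finset.sum_congr rfl fun i _ => Finset.sum_congr rfl fun j _ => ?_
    rw [Matrix.of_apply, if_pos rfl]
    ring
  | zero => exact ⟨0, fun x y => by simp⟩
  | add H K _ _ hH hK =>
    obtain ⟨b, hb⟩ := hH
    obtain ⟨c, hc⟩ := hK
    refine ⟨b + c, fun x y => ?_⟩
    rw [Pi.add_apply, Pi.add_apply, hb, hc, ← Finset.sum_add_distrib]
    simp only [Pi.add_apply, Matrix.add_apply, add_mul, Finset.sum_add_distrib, mul_add]
  | smul t H _ hH =>
    obtain ⟨b, hb⟩ := hH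
    refine ⟨t • b, fun x y => ?_⟩
    rw [Pi.smul_apply, Pi.smul_apply, hb, smul_eq_mul, Finset.mul_sum]
    refine Finset.sum_congr rfl fun k _ => ?_
    rw [mul_left_comm, Finset.mul_sum]
    congr 1
    refine Finset.sum_congr rfl fun i _ => ?_
    rw [Finset.mul_sum]
    exact Finset.sum_congr rfl fun j _ => by
      simp only [Pi.smul_apply, Matrix.smul_apply, smul_eq_mul]; ring

theorem mul_mem_wedgeSpan {n : ℕ} {H : (Fin 3 → ℂ) → (Fin 3 → ℂ) → ℂ} (h : H ∈ wedgeSpan n)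
    (k l : Fin 3) : (fun x y => x k * y l * H x y) ∈ wedgeSpan (n + 1) := by
  induction h using Submodule.span_induction with
  | mem H h =>
    obtain ⟨f, g, i, hf, hg, rfl⟩ := h
    refine Submodule.subset_span ⟨f * X k, g * X l, i, hf.mul (isHomogeneous_X ℂ k),
      hg.mul (isHomogeneous_X ℂ l), ?_⟩
    ext x y
    simp only [map_mul, eval_X]
    ring
  | zero =>
    convert Submodule.zero_mem (wedgeSpan (n + 1)) using 1
    ext x y
    simp
  | add H K _ _ hH hK =>
    convert Submodule.add_mem _ hH hK using 1
    ext x y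
    simp [mul_add]
  | smul t H _ hH =>
    convert Submodule.smul_mem _ t hH using 1
    ext x y
    simp only [Pi.smul_apply, smul_eq_mul]
    ring

theorem wedge_mul_mem_wedgeSpan {n : ℕ} {f g : MvPolynomial (Fin 3) ℂ} (hf : f.IsHomogeneous n)
    (hg : g.IsHomogeneous n) (k l : Fin 3) :
    (fun x y => (x k * y l - x l * y k) * (eval x f * eval y g)) ∈ wedgeSpan n := by
  have key : ∀ i : Fin 3, (fun x y : Fin 3 → ℂ =>
      (x (i + 1) * y (i + 2) - x (i + 2) * y (i + 1)) * (eval x f * eval y g)) ∈ wedgeSpan n :=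
    fun i => Submodule.subset_span ⟨f, g, i, hf, hg, rfl⟩
  have swap : (fun x y : Fin 3 → ℂ => (x k * y l - x l * y k) * (eval x f * eval y g))
      = -fun x y : Fin 3 → ℂ => (x l * y k - x k * y l) * (eval x f * eval y g) := by
    ext x y
    simp only [Pi.neg_apply]
    ring
  obtain h | h | h : k = l ∨ (∃ i : Fin 3, k = i + 1 ∧ l = i + 2) ∨
      ∃ i : Fin 3, l = i + 1 ∧ k = i + 2 := by
    clear * -; revert k l; decide
  · subst h
    convert Submodule.zero_mem (wedgeSpan n) using 1
    ext x y
    simp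
  · obtain ⟨i, rfl, rfl⟩ := h
    exact key i
  · obtain ⟨i, rfl, rfl⟩ := h
    rw [swap]
    exact Submodule.neg_mem _ (key i)

/-- Induction on the degree. With s = xₖ s' and t = xₗ t', the antisymmetrization is (xₖ yₗ - xₗ yₖ)
s'(x) t'(y) + xₗ yₖ (s'(x) t'(y) - t'(x) s'(y)). -/
theorem monomial_wedge_mem {n : ℕ} : ∀ s t : Fin 3 →₀ ℕ, s.degree = n + 1 → t.degree = n + 1 →
    (fun x y => eval x (monomial s (1 : ℂ)) * eval y (monomial t (1 : ℂ))
      - eval x (monomial t (1 : ℂ)) * eval y (monomial s (1 : ℂ))) ∈ wedgeSpan n := by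
  have split : ∀ (n : ℕ) (s : Fin 3 →₀ ℕ), s.degree = n + 1 → ∃ (k : Fin 3) (s' : Fin 3 →₀ ℕ),
      s'.degree = n ∧ monomial s (1 : ℂ) = X k * monomial s' 1 := by
    intro n s hs
    obtain ⟨k, hk⟩ : ∃ k, s k ≠ 0 := by
      by_contra! h
      have : s = 0 := Finsupp.ext h
      simp [this] at hs
    have hle : Finsupp.single k 1 ≤ s := by
      rw [Finsupp.single_le_iff]; omega
    refine ⟨k, s - Finsupp.single k 1, ?_, ?_⟩
    · have := congrArg Finsupp.degree (tsub_add_cancel_of_le hle)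
      rw [map_add, Finsupp.degree_single, hs] at this
      omega
    · rw [X, monomial_mul, add_tsub_cancel_of_le hle, one_mul]
  induction n with
  | zero =>
    intro s t hs ht
    obtain ⟨k, s', hs', es⟩ := split 0 s hs
    obtain ⟨l, t', ht', et⟩ := split 0 t ht
    rw [Finsupp.degree_eq_zero_iff] at hs' ht'
    subst hs' ht'
    have := wedge_mul_mem_wedgeSpan (isHomogeneous_one (Fin 3) ℂ) (isHomogeneous_one (Fin 3) ℂ) k l
    rw [es, et]
    simpa [mul_comm] using this
  | succ n ih =>
    intro s t hs ht
    obtain ⟨k, s', hs', es⟩ := split _ s hs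
    obtain ⟨l, t', ht', et⟩ := split _ t ht
    have h1 := wedge_mul_mem_wedgeSpan (isHomogeneous_monomial (1 : ℂ) hs')
      (isHomogeneous_monomial (1 : ℂ) ht') k l
    have h2 := mul_mem_wedgeSpan (ih s' t' hs' ht') l k
    convert Submodule.add_mem _ h1 h2 using 1
    ext x y
    rw [es, et]
    simp only [map_mul, eval_X, Pi.add_apply]
    ring

theorem wedge_mem_wedgeSpan {n : ℕ} {p q : MvPolynomial (Fin 3) ℂ} (hp : p.IsHomogeneous (n + 1))
    (hq : q.IsHomogeneous (n + 1)) :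
    (fun x y => eval x p * eval y q - eval x q * eval y p) ∈ wedgeSpan n := by
  have e : ∀ (f : MvPolynomial (Fin 3) ℂ) x, eval x f
      = ∑ s ∈ f.support, coeff s f * eval x (monomial s (1 : ℂ)) := fun f x => by
    rw [eval_eq]
    exact Finset.sum_congr rfl fun s _ => by simp [eval_monomial, Finsupp.prod]
  have h : (fun x y => eval x p * eval y q - eval x q * eval y p)
      = ∑ s ∈ p.support, ∑ t ∈ q.support, (coeff s p * coeff t q) •
        fun x y => eval x (monomial s (1 : ℂ)) * eval y (monomial t (1 : ℂ))
          - eval x (monomial t (1 : ℂ)) * eval y (monomial s (1 : ℂ)) := by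
    ext x y
    simp only [Finset.sum_apply, Pi.smul_apply, smul_eq_mul, mul_sub, Finset.sum_sub_distrib]
    rw [e p x, e q y, e q x, e p y, Finset.sum_mul_sum, mul_comm (∑ _ ∈ q.support, _),
      Finset.sum_mul_sum]
    congr 1 <;>
    exact Finset.sum_congr rfl fun _ _ => Finset.sum_congr rfl fun _ _ => by ring
  rw [h]
  refine Submodule.sum_mem _ fun s hs => Submodule.sum_mem _ fun t ht => Submodule.smul_mem _ _ ?_
  refine monomial_wedge_mem s t ?_ ?_
  · rw [Finsupp.degree_eq_weight_one]
    exact hp (mem_support_iff.1 hs)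
  · rw [Finsupp.degree_eq_weight_one]
    exact hq (mem_support_iff.1 ht)

/-- The coefficient matrices of a Bezout triple in cyclic notation. -/
def cyclicTriple {n : ℕ} (β10 β20 β12 : Matrix (MonomialIndex n) (MonomialIndex n) ℂ) :
    Fin 3 → Matrix (MonomialIndex n) (MonomialIndex n) ℂ :=
  ![β12, β20, -β10]

/-- The sign of β¹⁰ comes from (x × y)₂ = -(x₁ y₀ - x₀ y₁). In B it cancels against the sign of D₂
in the pencil. -/
theorem bezoutIdentity_cyclicTriple_iff {n : ℕ} {p q : MvPolynomial (Fin 3) ℂ}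
    {β10 β20 β12 : Matrix (MonomialIndex n) (MonomialIndex n) ℂ} :
    BezoutIdentity (cyclicTriple β10 β20 β12) p q ↔ ∀ x y : Fin 3 → ℂ,
      eval x p * eval y q - eval x q * eval y p
        = ∑ i : MonomialIndex n, ∑ j : MonomialIndex n,
        (β10 i j * i.eval x * (x 1 * y 0 - x 0 * y 1) * j.eval y
          + β20 i j * i.eval x * (x 2 * y 0 - x 0 * y 2) * j.eval y
          + β12 i j * i.eval x * (x 1 * y 2 - x 2 * y 1) * j.eval y) := by
  refine forall_congr' fun x => forall_congr' fun y => ?_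
  have h : ∑ k : Fin 3, (x (k + 1) * y (k + 2) - x (k + 2) * y (k + 1))
        * ∑ i, ∑ j, cyclicTriple β10 β20 β12 k i j * MonomialIndex.eval i x * MonomialIndex.eval j y
      = ∑ i : MonomialIndex n, ∑ j : MonomialIndex n,
        (β10 i j * i.eval x * (x 1 * y 0 - x 0 * y 1) * j.eval y
          + β20 i j * i.eval x * (x 2 * y 0 - x 0 * y 2) * j.eval y
          + β12 i j * i.eval x * (x 1 * y 2 - x 2 * y 1) * j.eval y) := by
    simp only [Fin.sum_univ_three, Finset.mul_sum, ← Finset.sum_add_distrib]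
    refine Finset.sum_congr rfl fun i _ => Finset.sum_congr rfl fun j _ => ?_
    simp only [cyclicTriple, Fin.isValue, Fin.reduceAdd, zero_add, Matrix.cons_val_zero,
      Matrix.cons_val_one, Matrix.cons_val, Matrix.neg_apply]
    ring
  rw [h]

theorem exists_isBezoutTriple {n : ℕ} (hn : 1 ≤ n) {p q : MvPolynomial (Fin 3) ℂ}
    (hp : p.IsHomogeneous n) (hq : q.IsHomogeneous n) :
    ∃ β10 β20 β12 : Matrix (MonomialIndex n) (MonomialIndex n) ℂ,
      IsBezoutTriple p q β10 β20 β12 := by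
  obtain ⟨n, rfl⟩ := Nat.exists_eq_add_of_le' hn
  obtain ⟨b, hb⟩ := exists_coefficients_of_mem_wedgeSpan (wedge_mem_wedgeSpan hp hq)
  -- Both the left side and x × y change sign when x and y are exchanged, so the symmetric parts
  -- satisfy the same identity.
  let c : Fin 3 → Matrix (MonomialIndex (n + 1)) (MonomialIndex (n + 1)) ℂ :=
    fun k => (1 / 2 : ℂ) • (b k + (b k).transpose)
  have hc : BezoutIdentity c p q := fun x y => by
    have h2 : ∀ k : Fin 3, ∑ i, ∑ j, c k i j * MonomialIndex.eval i x * MonomialIndex.eval j y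
        = (1 / 2) * (∑ i, ∑ j, b k i j * MonomialIndex.eval i x * MonomialIndex.eval j y
          + ∑ i, ∑ j, b k i j * MonomialIndex.eval i y * MonomialIndex.eval j x) := fun k => by
      rw [Finset.sum_comm (f := fun i j => b k i j * MonomialIndex.eval i y * _),
        ← Finset.sum_add_distrib, Finset.mul_sum]
      refine Finset.sum_congr rfl fun i _ => ?_
      rw [← Finset.sum_add_distrib, Finset.mul_sum]
      refine Finset.sum_congr rfl fun j _ => ?_
      simp only [c, Matrix.smul_apply, Matrix.add_apply, Matrix.transpose_apply, smul_eq_mul]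
      ring
    have e1 := hb x y
    have e2 := hb y x
    simp only [h2]
    simp only [Fin.sum_univ_three] at e1 e2 ⊢
    linear_combination (1 / 2) * e1 - (1 / 2) * e2
  have hsymm : ∀ k, (c k).IsSymm := fun k => by
    rw [Matrix.IsSymm, Matrix.transpose_smul, Matrix.transpose_add, Matrix.transpose_transpose,
      add_comm (b k).transpose]
  refine ⟨-c 2, c 1, c 0, ?_, hsymm 1, hsymm 0, bezoutIdentity_cyclicTriple_iff.1 ?_⟩
  · rw [Matrix.IsSymm, Matrix.transpose_neg, hsymm 2]
  · have : cyclicTriple (-c 2) (c 1) (c 0) = c := by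
      ext1 k
      fin_cases k <;> simp [cyclicTriple]
    rwa [this]

end Existence

/-! ### A common zero produces a kernel vector -/

section CommonZero

variable {m n : ℕ}

/-- Subtracting multiples of the i-th entry, u = Xⱼ - (yⱼ/yᵢ) Xᵢ and v = Xₗ - (yₗ/yᵢ) Xᵢ satisfy v
g̃ⱼ = u g̃ₗ, where g̃ is reduced in the same way. As u is prime and does not divide v, g̃ⱼ = u r and
g̃ₗ = v r. -/
theorem exists_combination_of_cross {i j l : Fin 3} (hij : i ≠ j) (hil : i ≠ l) (hjl : j ≠ l)
    {y : Fin 3 → ℂ} (hy : y i ≠ 0) {g : Fin 3 → MvPolynomial (Fin 3) ℂ}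
    (h : (X j * C (y l) - X l * C (y j)) * g i + (X l * C (y i) - X i * C (y l)) * g j
      + (X i * C (y j) - X j * C (y i)) * g l = 0) :
    ∃ r e, g i = r * X i + e * C (y i) ∧ g j = r * X j + e * C (y j)
      ∧ g l = r * X l + e * C (y l) := by
  have hC : (C (y i)⁻¹ * C (y i) : MvPolynomial (Fin 3) ℂ) = 1 := by
    rw [← C_mul, inv_mul_cancel₀ hy, C_1]
  have hu := prime_X_sub_C_mul_X hij ((y i)⁻¹ * y j)
  rw [C_mul] at hu
  have h1 : (X l - C (y i)⁻¹ * C (y l) * X i) * (g j - C (y i)⁻¹ * C (y j) * g i)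
      = (X j - C (y i)⁻¹ * C (y j) * X i) * (g l - C (y i)⁻¹ * C (y l) * g i) := by
    linear_combination C (y i)⁻¹ * h - (X l * g j - X j * g l) * hC
  have h2 : ¬ (X j - C (y i)⁻¹ * C (y j) * X i) ∣ (X l - C (y i)⁻¹ * C (y l) * X i) := by
    rintro ⟨w, hw⟩
    have := congrArg (eval (Pi.single l (1 : ℂ))) hw
    simp [hil, hjl] at this
  obtain ⟨r, hr⟩ := (hu.dvd_or_dvd ⟨_, h1⟩).resolve_left h2
  have h3 : g l - C (y i)⁻¹ * C (y l) * g i = (X l - C (y i)⁻¹ * C (y l) * X i) * r := by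
    refine mul_left_cancel₀ hu.ne_zero ?_
    rw [← h1, hr]
    ring
  refine ⟨r, C (y i)⁻¹ * (g i - r * X i), ?_, ?_, ?_⟩
  · linear_combination -(g i - r * X i) * hC
  · linear_combination hr
  · linear_combination h3

/-- A vector of polynomials in `x` orthogonal to `x × y` is a combination of `x` and `y`. -/
theorem exists_combination_of_sum_cross {y : Fin 3 → ℂ} (hy : y ≠ 0)
    {g : Fin 3 → MvPolynomial (Fin 3) ℂ}
    (h : ∑ k : Fin 3, (X (k + 1) * C (y (k + 2)) - X (k + 2) * C (y (k + 1))) * g k = 0) :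
    ∃ r e, ∀ k, g k = r * X k + e * C (y k) := by
  obtain ⟨i, hi⟩ := Function.ne_iff.1 hy
  have h' : (X (i + 1) * C (y (i + 2)) - X (i + 2) * C (y (i + 1))) * g i
      + (X (i + 2) * C (y i) - X i * C (y (i + 2))) * g (i + 1)
      + (X i * C (y (i + 1)) - X (i + 1) * C (y i)) * g (i + 2) = 0 := by
    rw [← h, Fin.sum_univ_three]
    fin_cases i <;> simp <;> ring
  obtain ⟨r, e, h0, h1, h2⟩ := exists_combination_of_cross (by clear * -; revert i; decide)
    (by clear * -; revert i; decide) (by clear * -; revert i; decide) hi h'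
  refine ⟨r, e, fun k => ?_⟩
  obtain rfl | rfl | rfl : k = i ∨ k = i + 1 ∨ k = i + 2 := by
    clear * -; revert i k; decide
  · exact h0
  · exact h1
  · exact h2

/-- Evaluation at the point `y`, times the vector `ξ`. -/
noncomputable def evalFunctional (y : Fin 3 → ℂ) (ξ : Fin m → ℂ) :
    MvPolynomial (Fin 3) ℂ →ₗ[ℂ] (Fin m → ℂ) :=
  LinearMap.smulRight (aeval y : MvPolynomial (Fin 3) ℂ →ₐ[ℂ] ℂ).toLinearMap ξ

@[simp]
theorem evalFunctional_apply (y : Fin 3 → ℂ) (ξ : Fin m → ℂ) (f : MvPolynomial (Fin 3) ℂ) :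
    evalFunctional y ξ f = eval y f • ξ := by
  simp [evalFunctional, aeval_eq_eval]

theorem bezoutVector_evalFunctional_mem {d : Fin 3 → Matrix (Fin m) (Fin m) ℂ}
    {b : Fin 3 → Matrix (MonomialIndex n) (MonomialIndex n) ℂ}
    {p q : MvPolynomial (Fin 3) ℂ} (hb : BezoutIdentity b p q) {y : Fin 3 → ℂ} (hy : y ≠ 0)
    (hp : eval y p = 0) (hq : eval y q = 0) {ξ : Fin m → ℂ}
    (hξ : (∑ k, y k • d k).mulVec ξ = 0) :
    bezoutVector d b (evalFunctional y ξ) ∈ LinearMap.range (pencil d).mulVecLin := by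
  let g : Fin 3 → MvPolynomial (Fin 3) ℂ := fun k => ∑ i, ∑ j, C (b k i j * j.eval y) * i.toPoly
  have hrow : ∀ k, bezoutRow (b k) (evalFunctional y ξ)
      = g k • fun a => (C (ξ a) : MvPolynomial (Fin 3) ℂ) := fun k => by
    ext1 a
    simp only [bezoutRow, evalFunctional_apply, MonomialIndex.eval_toPoly, Pi.smul_apply,
      smul_eq_mul, g, Finset.sum_mul, C_mul]
    exact Finset.sum_congr rfl fun i _ => Finset.sum_congr rfl fun j _ => by ring
  have hg : ∑ k : Fin 3, (X (k + 1) * C (y (k + 2)) - X (k + 2) * C (y (k + 1))) * g k = 0 := by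
    refine MvPolynomial.funext fun x => ?_
    have := hb x y
    rw [hp, hq, mul_zero, mul_zero, sub_zero] at this
    rw [map_zero, this]
    simp only [g, map_sum, map_mul, map_sub, eval_X, eval_C, MonomialIndex.eval_toPoly]
    refine Finset.sum_congr rfl fun k _ => ?_
    congr 1
    exact Finset.sum_congr rfl fun i _ => Finset.sum_congr rfl fun j _ => by ring
  obtain ⟨r, e, hre⟩ := exists_combination_of_sum_cross hy hg
  refine ⟨r • fun a => (C (ξ a) : MvPolynomial (Fin 3) ℂ), ?_⟩
  have hξ' : ∑ k, (C (y k) : MvPolynomial (Fin 3) ℂ) •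
      ((d k).map C).mulVec (fun a => (C (ξ a) : MvPolynomial (Fin 3) ℂ)) = 0 := by
    ext1 a
    have := congrArg (C : ℂ → MvPolynomial (Fin 3) ℂ) (congrFun hξ a)
    simp only [Matrix.sum_mulVec, Matrix.smul_mulVec, Finset.sum_apply, map_sum, Pi.smul_apply,
      smul_eq_mul, C_mul, Pi.zero_apply, C_0] at this
    simpa [map_C_mulVec] using this
  simp only [bezoutVector, hrow, hre, Matrix.mulVecLin_apply, pencil, Matrix.sum_mulVec,
    Matrix.smul_mulVec, Matrix.mulVec_smul, Matrix.mulVec_add, add_smul, mul_smul,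
    Finset.sum_add_distrib]
  rw [← Finset.smul_sum, ← Finset.smul_sum, hξ', smul_zero, add_zero, Finset.smul_sum]

theorem isPrincipal_evalFunctional {d : Fin 3 → Matrix (Fin m) (Fin m) ℂ} {y : Fin 3 → ℂ}
    {ξ : Fin m → ℂ} (hξ : (∑ k, y k • d k).mulVec ξ = 0) : IsPrincipal d (evalFunctional y ξ) := by
  intro f
  have : ∑ k, (d k).mulVec (evalFunctional y ξ (X k * f))
      = eval y f • (∑ k, y k • d k).mulVec ξ := by
    rw [Matrix.sum_mulVec, Finset.smul_sum]
    refine Finset.sum_congr rfl fun k _ => ?_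
    rw [evalFunctional_apply, map_mul, eval_X, Matrix.mulVec_smul, Matrix.smul_mulVec, mul_comm,
      mul_smul]
  rw [this, hξ, smul_zero]

end CommonZero

/-! ### From the compressed matrix to functionals -/

section Translation

variable {m n : ℕ}

/-- The coefficients of the pencil `x₀ D₀ + x₁ D₁ - x₂ D₂`. -/
def signedPencil (D : Fin 3 → Matrix (Fin m) (Fin m) ℂ) : Fin 3 → Matrix (Fin m) (Fin m) ℂ :=
  ![D 0, D 1, -D 2]

theorem det_pencil_signedPencil (D : Fin 3 → Matrix (Fin m) (Fin m) ℂ) :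
    (pencil (signedPencil D)).det = determinantalPolynomial D := by
  have h : (-D 2).map (C : ℂ → MvPolynomial (Fin 3) ℂ) = -(D 2).map C := by
    ext1 a b
    simp
  rw [pencil, determinantalPolynomial, Fin.sum_univ_three, sub_eq_add_neg, ← smul_neg, ← h]
  rfl

theorem MonomialIndex.degree_symm (i : MonomialIndex n) :
    (Finsupp.equivFunOnFinite.symm i.1).degree + 1 = n := by
  rw [Finsupp.degree_eq_sum]
  exact i.2

theorem MonomialIndex.toPoly_raise (j : Fin 3 → ℕ) (hj : ∑ k, j k + 2 = n) (k : Fin 3) :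
    (MonomialIndex.raise j hj k).toPoly
      = X k * monomial (Finsupp.equivFunOnFinite.symm j) (1 : ℂ) := by
  have h : Finsupp.equivFunOnFinite.symm (j + Pi.single k 1)
      = Finsupp.single k 1 + Finsupp.equivFunOnFinite.symm j := by
    ext l
    simp [Finsupp.single_apply, Pi.single_apply, eq_comm, add_comm]
  rw [X, monomial_mul, one_mul, ← h]
  rfl

/-- The functional that takes the value `w i` at the monomial with exponent `i`. -/
noncomputable def vectorFunctional (w : BlownSpace m n) :
    MvPolynomial (Fin 3) ℂ →ₗ[ℂ] (Fin m → ℂ) :=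
  ∑ i : MonomialIndex n,
    (lcoeff ℂ (Finsupp.equivFunOnFinite.symm i.1)).smulRight (w.component i)

theorem vectorFunctional_apply (w : BlownSpace m n) (f : MvPolynomial (Fin 3) ℂ) :
    vectorFunctional w f
      = ∑ i : MonomialIndex n, coeff (Finsupp.equivFunOnFinite.symm i.1) f • w.component i := by
  simp [vectorFunctional]

@[simp]
theorem vectorFunctional_toPoly (w : BlownSpace m n) (i : MonomialIndex n) :
    vectorFunctional w i.toPoly = w.component i := by
  classical
  rw [vectorFunctional_apply, Finset.sum_eq_single i]
  · simp [MonomialIndex.toPoly]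
  · intro j _ hj
    rw [MonomialIndex.toPoly, coeff_monomial, if_neg, zero_smul]
    exact fun h => hj (Subtype.ext (Finsupp.equivFunOnFinite.symm.injective h).symm)
  · simp

theorem isOfDegree_vectorFunctional (w : BlownSpace m n) :
    IsOfDegree (n - 1) (vectorFunctional w) := by
  intro f
  rw [vectorFunctional_apply, vectorFunctional_apply]
  refine Finset.sum_congr rfl fun i _ => ?_
  rw [coeff_homogeneousComponent, if_pos]
  have := i.degree_symm
  omega

theorem mem_principalSubspace_iff {D : Fin 3 → Matrix (Fin m) (Fin m) ℂ} {w : BlownSpace m n} :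
    w ∈ principalSubspace D n ↔ ∀ (j : Fin 3 → ℕ) (hj : ∑ k, j k + 2 = n),
      ∑ k, (signedPencil D k).mulVec (w.component (MonomialIndex.raise j hj k)) = 0 := by
  refine forall₂_congr fun j hj => ?_
  simp [Fin.sum_univ_three, signedPencil, sub_eq_add_neg, Matrix.neg_mulVec]

theorem isPrincipal_vectorFunctional {D : Fin 3 → Matrix (Fin m) (Fin m) ℂ}
    {w : BlownSpace m n} (hw : w ∈ principalSubspace D n) :
    IsPrincipal (signedPencil D) (vectorFunctional w) := by
  rw [mem_principalSubspace_iff] at hw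
  intro f
  induction f using MvPolynomial.induction_on' with
  | monomial s c =>
    have hs : monomial s c = c • monomial s (1 : ℂ) := by simp [smul_monomial]
    simp only [hs, mul_smul_comm, map_smul, Matrix.mulVec_smul, ← Finset.smul_sum]
    convert smul_zero c
    by_cases h : s.degree + 2 = n
    · have hj : ∑ k, s k + 2 = n := by rw [← Finsupp.degree_eq_sum, h]
      have e : Finsupp.equivFunOnFinite.symm (s : Fin 3 → ℕ) = s := by ext; simp
      have := hw s hj
      simp only [← vectorFunctional_toPoly, MonomialIndex.toPoly_raise, e] at this
      exact this
    · refine Finset.sum_eq_zero fun k _ => ?_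
      rw [(isOfDegree_vectorFunctional w).eq_zero
        ((isHomogeneous_X ℂ k).mul (isHomogeneous_monomial (1 : ℂ) rfl)) (by omega),
        Matrix.mulVec_zero]
  | add f g hf hg =>
    simp only [mul_add, map_add, Matrix.mulVec_add, Finset.sum_add_distrib, hf, hg, add_zero]

/-- The element of the blown up space with components the values of `φ` at monomials. -/
noncomputable def functionalVector (n : ℕ) (φ : MvPolynomial (Fin 3) ℂ →ₗ[ℂ] (Fin m → ℂ)) : BlownSpace m n :=
  WithLp.toLp 2 fun x => φ x.1.toPoly x.2

theorem component_functionalVector (φ : MvPolynomial (Fin 3) ℂ →ₗ[ℂ] (Fin m → ℂ))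
    (i : MonomialIndex n) : (functionalVector n φ).component i = φ i.toPoly := rfl

theorem functionalVector_mem {D : Fin 3 → Matrix (Fin m) (Fin m) ℂ}
    {φ : MvPolynomial (Fin 3) ℂ →ₗ[ℂ] (Fin m → ℂ)} (h : IsPrincipal (signedPencil D) φ) :
    functionalVector n φ ∈ principalSubspace D n := by
  rw [mem_principalSubspace_iff]
  intro j hj
  simpa only [component_functionalVector, MonomialIndex.toPoly_raise] using h _

/-- The entrywise complex conjugate. -/
def BlownSpace.conj (w : BlownSpace m n) : BlownSpace m n := WithLp.toLp 2 fun x => star (w x)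

theorem BlownSpace.conj_mem {D : Fin 3 → Matrix (Fin m) (Fin m) ℂ} {w : BlownSpace m n}
    (hw : w ∈ principalSubspace D n) :
    w.conj ∈ principalSubspace (fun k => (D k).map star) n := by
  have key : ∀ (A : Matrix (Fin m) (Fin m) ℂ) (i : MonomialIndex n),
      (A.map star).mulVec (w.conj.component i) = star (A.mulVec (w.component i)) := by
    intro A i
    ext a
    simp [Matrix.mulVec, dotProduct, BlownSpace.conj, BlownSpace.component]
  intro j hj
  rw [key, key, key, ← star_add, ← star_sub, hw j hj, star_zero]

theorem map_star_of_isHermitian {A : Matrix (Fin m) (Fin m) ℂ} (hA : A.IsHermitian) :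
    A.map star = A.transpose := by
  conv_rhs => rw [← hA.eq]
  rfl

theorem signedPencil_transpose (D : Fin 3 → Matrix (Fin m) (Fin m) ℂ) :
    signedPencil (fun k => (D k).transpose) = fun k => (signedPencil D k).transpose := by
  ext1 k
  fin_cases k <;> simp [signedPencil]

theorem bezoutVector_vectorFunctional (D : Fin 3 → Matrix (Fin m) (Fin m) ℂ)
    (β10 β20 β12 : Matrix (MonomialIndex n) (MonomialIndex n) ℂ) (v : BlownSpace m n) :
    bezoutVector (signedPencil D) (cyclicTriple β10 β20 β12) (vectorFunctional v) = fun a =>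
      ∑ i, C (Matrix.toEuclideanLin (blownBezoutMatrix D β10 β20 β12) v (i, a)) * i.toPoly := by
  ext1 a
  refine MvPolynomial.funext fun x => ?_
  have h : ∀ i, Matrix.toEuclideanLin (blownBezoutMatrix D β10 β20 β12) v (i, a)
      = ∑ k, ∑ c, signedPencil D k a c
          * ∑ j, cyclicTriple β10 β20 β12 k i j * v (j, c) := fun i => by
    simp only [Matrix.toLpLin_apply, Matrix.mulVec, dotProduct, Fintype.sum_prod_type,
      Fin.sum_univ_three, Finset.mul_sum]
    simp only [← Finset.sum_add_distrib]
    rw [Finset.sum_comm]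
    refine Finset.sum_congr rfl fun c _ => Finset.sum_congr rfl fun j _ => ?_
    simp only [blownBezoutMatrix, signedPencil, cyclicTriple, Matrix.add_apply,
      Matrix.kroneckerMap_apply, Matrix.cons_val_zero, Matrix.cons_val_one, Matrix.cons_val,
      Matrix.neg_apply]
    ring
  simp only [bezoutVector, Finset.sum_apply, map_sum, Matrix.mulVec, dotProduct,
    Matrix.map_apply, map_mul, eval_C, bezoutRow, MonomialIndex.eval_toPoly,
    vectorFunctional_toPoly, h, BlownSpace.component, Finset.sum_mul, Finset.mul_sum]
  rw [Finset.sum_comm (s := (Finset.univ : Finset (MonomialIndex n)))]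
  refine Finset.sum_congr rfl fun k _ => ?_
  rw [Finset.sum_comm (s := (Finset.univ : Finset (MonomialIndex n)))]
  exact Finset.sum_congr rfl fun c _ => Finset.sum_congr rfl fun i _ =>
    Finset.sum_congr rfl fun j _ => by ring

theorem inner_eq_toFunctional (D : Fin 3 → Matrix (Fin m) (Fin m) ℂ)
    (β10 β20 β12 : Matrix (MonomialIndex n) (MonomialIndex n) ℂ) (v w : BlownSpace m n)
    {ψ : MvPolynomial (Fin 3) ℂ →ₗ[ℂ] (Fin m → ℂ)}
    (hψ : ∀ i, ψ i.toPoly = w.conj.component i) :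
    inner ℂ w (Matrix.toEuclideanLin (blownBezoutMatrix D β10 β20 β12) v)
      = toFunctional ψ (bezoutVector (signedPencil D) (cyclicTriple β10 β20 β12)
          (vectorFunctional v)) := by
  rw [bezoutVector_vectorFunctional, toFunctional_apply, PiLp.inner_apply,
    Fintype.sum_prod_type_right]
  refine Finset.sum_congr rfl fun a _ => ?_
  rw [map_sum, Finset.sum_apply]
  refine Finset.sum_congr rfl fun i _ => ?_
  rw [← smul_eq_C_mul, map_smul, hψ]
  rfl

/-- A polynomial vector outside the image of the pencil is separated from it by a functional, which
is principal for the transposed pencil. Pairing with the Bezout vector uses only its values at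
monomials of degree n - 1; their conjugate lies in V_n because the Dₖ are Hermitian. So
orthogonality to V_n is membership in the image. -/
theorem bezoutAlongCurve_eq_zero_iff {D : Fin 3 → Matrix (Fin m) (Fin m) ℂ}
    (hD : ∀ k, (D k).IsHermitian)
    (β10 β20 β12 : Matrix (MonomialIndex n) (MonomialIndex n) ℂ) (v : principalSubspace D n) :
    bezoutAlongCurve D β10 β20 β12 v = 0 ↔
      bezoutVector (signedPencil D) (cyclicTriple β10 β20 β12) (vectorFunctional v.1)
        ∈ LinearMap.range (pencil (signedPencil D)).mulVecLin := by
  have hT : (fun k => (D k).map star) = fun k => (D k).transpose :=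
    funext fun k => map_star_of_isHermitian (hD k)
  have hT' : (fun k => ((D k).transpose).map star) = D := funext fun k => by
    rw [map_star_of_isHermitian (hD k).transpose, Matrix.transpose_transpose]
  have hTT : (pencil (signedPencil fun k => (D k).transpose)).transpose
      = pencil (signedPencil D) := by
    rw [pencil_transpose, signedPencil_transpose]
    rfl
  have h0 : bezoutAlongCurve D β10 β20 β12 v = 0 ↔ ∀ w ∈ principalSubspace D n,
      inner ℂ w (Matrix.toEuclideanLin (blownBezoutMatrix D β10 β20 β12) v.1) = 0 := by
    rw [← Submodule.mem_orthogonal, ← Submodule.orthogonalProjectionOnto_eq_zero_iff]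
    rfl
  rw [h0]
  constructor
  · intro h
    by_contra hmem
    obtain ⟨ψ, hψ, hker⟩ := Submodule.exists_le_ker_of_notMem
      (p := (LinearMap.range (pencil (signedPencil D)).mulVecLin).restrictScalars ℂ) hmem
    have hp : IsPrincipal (signedPencil fun k => (D k).transpose) (ofFunctional ψ) :=
      isPrincipal_ofFunctional fun G => by
        rw [hTT]
        exact hker ⟨G, rfl⟩
    have hw := BlownSpace.conj_mem (functionalVector_mem (n := n) hp)
    rw [hT'] at hw
    refine hψ ?_
    rw [← toFunctional_ofFunctional ψ, ← inner_eq_toFunctional D β10 β20 β12 v.1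
      (functionalVector n (ofFunctional ψ)).conj (fun i => ?_)]
    · exact h _ hw
    · ext a
      simp [BlownSpace.conj, BlownSpace.component, functionalVector]
  · rintro ⟨G, hG⟩ w hw
    have hw' := BlownSpace.conj_mem hw
    rw [hT] at hw'
    rw [inner_eq_toFunctional D β10 β20 β12 v.1 w
      (fun i => vectorFunctional_toPoly w.conj i), ← hG, Matrix.mulVecLin_apply, ← hTT]
    exact (isPrincipal_vectorFunctional hw').toFunctional_eq_zero G

end Translation

/-! ### The equivalence -/

theorem corollary2p2 (m n : ℕ) (hn : 1 ≤ n)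
    (D : Fin 3 → Matrix (Fin m) (Fin m) ℂ) (hD : ∀ k, (D k).IsHermitian)
    (hΔ : determinantalPolynomial D ≠ 0)
    (p q : MvPolynomial (Fin 3) ℂ) (hp : p.IsHomogeneous n) (hq : q.IsHomogeneous n) :
    (∃ β10 β20 β12 : Matrix (MonomialIndex n) (MonomialIndex n) ℂ,
      IsBezoutTriple p q β10 β20 β12) ∧
    ∀ β10 β20 β12 : Matrix (MonomialIndex n) (MonomialIndex n) ℂ,
      IsBezoutTriple p q β10 β20 β12 →
        (HasCommonZeroOnCurve D p q ↔ LinearMap.det (bezoutAlongCurve D β10 β20 β12) = 0) := by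
  refine ⟨exists_isBezoutTriple hn hp hq, fun β10 β20 β12 hβ => ?_⟩
  have hb := bezoutIdentity_cyclicTriple_iff.2 hβ.identity
  rw [LinearMap.det_eq_zero_iff_ker_ne_bot, Submodule.ne_bot_iff]
  constructor
  · rintro ⟨y, hy, hyΔ, hyp, hyq⟩
    rw [← det_pencil_signedPencil, eval_det_pencil] at hyΔ
    obtain ⟨ξ, hξ0, hξ⟩ := Matrix.exists_mulVec_eq_zero_iff.2 hyΔ
    have hw : functionalVector n (evalFunctional y ξ) ∈ principalSubspace D n :=
      functionalVector_mem (isPrincipal_evalFunctional hξ)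
    have hvec : bezoutVector (signedPencil D) (cyclicTriple β10 β20 β12)
        (vectorFunctional (functionalVector n (evalFunctional y ξ)))
        = bezoutVector (signedPencil D) (cyclicTriple β10 β20 β12) (evalFunctional y ξ) := by
      refine Finset.sum_congr rfl fun k _ => congrArg _ (funext fun a => ?_)
      simp only [bezoutRow, vectorFunctional_toPoly, component_functionalVector]
    refine ⟨⟨_, hw⟩, ?_, fun h => ?_⟩
    · rw [LinearMap.mem_ker, bezoutAlongCurve_eq_zero_iff hD, hvec]
      exact bezoutVector_evalFunctional_mem hb hy hyp hyq hξ
    · obtain ⟨k, hk⟩ := Function.ne_iff.1 hy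
      obtain ⟨a, ha⟩ := Function.ne_iff.1 hξ0
      -- The monomial xₖ^(n-1) is nonzero at y because yₖ ≠ 0, so the evaluation functional gives a
      -- nonzero vector.
      let i : MonomialIndex n := ⟨Pi.single k (n - 1), by simp; omega⟩
      have h1 : (functionalVector n (evalFunctional y ξ)).component i a = 0 := by
        rw [show functionalVector n (evalFunctional y ξ) = 0 from congrArg Subtype.val h]
        rfl
      rw [component_functionalVector, evalFunctional_apply, Pi.smul_apply, smul_eq_mul,
        MonomialIndex.eval_toPoly, mul_eq_zero, or_iff_left (show ¬ ξ a = 0 from ha), MonomialIndex.eval,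
        Finset.prod_eq_zero_iff] at h1
      obtain ⟨l, -, hl⟩ := h1
      by_cases hlk : l = k
      · subst hlk
        exact hk (eq_zero_of_pow_eq_zero hl)
      · simp [i, hlk] at hl
  · rintro ⟨v, hv, hv0⟩
    rw [LinearMap.mem_ker, bezoutAlongCurve_eq_zero_iff hD] at hv
    by_contra hno
    have h := (isPrincipal_vectorFunctional v.2).eq_zero hn hp hq hb
      (by rwa [det_pencil_signedPencil]) (fun x h1 h2 h3 => by
        by_contra hx
        exact hno ⟨x, hx, by rwa [← det_pencil_signedPencil], h2, h3⟩)
      (isOfDegree_vectorFunctional v.1) hv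
    refine hv0 (Subtype.ext (PiLp.ext fun x => ?_))
    have := vectorFunctional_toPoly v.1 x.1
    rw [h] at this
    exact (congrFun this x.2).symm
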